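/- **Setting.** Let $r_1,\dots,r_n>0$, $r_0=\min_i r_i$, $\Delta^r_\varepsilon x=(\varepsilon^{r_1}x_1,\dots,\varepsilon^{r_n}x_n)$ for $\varepsilon>0$. A function $F$ is homogeneous of degree $m$ if $F(\Delta^r_\varepsilon x)=\varepsilon^mF(x)$, and a vector field $\varphi$ is homogeneous of degree $m$ if $\varphi_i(\Delta^r_\varepsilon x)=\varepsilon^{m+r_i}\varphi_i(x)$, for all $\varepsilon>0$, all $x$ and all $i$. Consider $$\dot x=f(x)+G_1(x)u+G_2(x)w,\qquad y=h(x)+du,$$ with $x\in\mathbb R^n$, $u\in\mathbb R$, $w\in\mathbb R^\xi$, $y\in\mathbb R^l$, where $f,G_1,G_2,h$ are continuous on $\mathbb R^n$ and $C^1$ on $\mathbb R^n\setminus\{0\}$, $f(0)=0$, $h(0)=0$, $f$ is homogeneous of degree $k>-r_0$, $G_1$ and the columns of $G_2$ are homogeneous of degree $-r_0$, the components of $h$ are homogeneous of degree $k+r_0$, and the constant vector $d$ satisfies $h(x)^Td=0$ for all $x$ and $d^Td=\vartheta^2$ with $\vartheta>0$. Let $V:\mathbb R^n\to\mathbb R$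 be positive definite, $C^1$ on $\mathbb R^n\setminus\{0\}$ and homogeneous of degree $k+2r_0$; $L_\varphi V(x)=\frac{\partial V}{\partial x}\varphi(x)$ for $x\ne0$ and $L_\varphi V(0)=0$. Let $\gamma$ be a $K_\infty$-function whose derivative $\gamma'$ exists and is also of class $K_\infty$, and suppose that its Legendre–Fenchel transform $\ell_\gamma(s)=s(\gamma')^{-1}(s)-\gamma((\gamma')^{-1}(s))$ satisfies $\ell_\gamma(2\varepsilon s)=\varepsilon^2\ell_\gamma(2s)$ for all $\varepsilon>0$, $s\ge0$. Let $R:\mathbb R^n\to(0,\infty)$ be homogeneous of degree zero, continuous on $\mathbb R^n\setminus\{0\}$ and bounded away from zero. Put $\tilde f(0)=0$ and, for $x\neq0$, $$\tilde f(x)=f(x)+G_2(x)\,\ell_\gamma(2|L_{G_2}V|)\frac{(L_{G_2}V)^T}{|L_{G_2}V|^2}$$ (the last term being $0$ where $L_{G_2}V=0$), and for $\kappa>0$, $\beta\ge 2$, $$\alpha(x)=-\frac{\kappa}{2\vartheta^2}R(x)^{-1}L_{G_1}V(x),\qquad \alpha^*(x)=\beta\,\alpha(x).$$ Put $H_\kappa(0)=0$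 and $H_\kappa(x)=-\kappa\big[L_{\tilde f}V+L_{G_1}V\,\alpha(x)\big]-h(x)^TR(x)h(x)$ for $x\ne0$. We say that $\alpha$ asymptotically stabilizes the auxiliary system $\dot x=\tilde f(x)+G_1(x)u$ with respect to $V$ if $L_{\tilde f}V(x)+L_{G_1}V(x)\alpha(x)<0$ for all $x\neq0$. **Cost.** Disturbances are locally square-integrable signals. Given functions $E,l,R_1,R_2,\gamma_0$, the cost of a (possibly time-varying) feedback law $u=a(t,x)$ from the initial state $x(0)$ is $$J(u)=\sup_{w}\ \lim_{t\to T}\Big[E(x(t))+\int_0^t\big(l(x)+u^TR_1(x)u+y^TR_2(x)y-\gamma_0(|w|)\big)\,d\tau\Big],$$ the supremum being over all disturbances $w$ with $\gamma_0(|w|)$ locally integrable and all corresponding solutions $x$ with $u$ locally square integrable. Here $T=\infty$ if the solution is global, and $T<\infty$ is the escape time if $|x(t)|\to\infty$ as $t\to T$; the limit is read as an upper limit when it does not exist. A law $a$ is admissible from $x(0)$ if for every continuous $\omega:\mathbb R^n\to\mathbb R^\xi$ with $\omega(0)=0$ the closed loop with $w=\omega(x)$ has a solution that is global or escapes to infinity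 in finite time, with $u$ and $w$ locally square integrable. **Theorem.** There is a constant $\kappa_0>0$ (depending only on the system, $V$, $\gamma$ and $R$) such that for every $\kappa>\kappa_0$ for which $\alpha$ asymptotically stabilizes the auxiliary system with respect to $V$, the function $H_\kappa$ is positive definite, and for every $\beta\ge2$ the control law $u=\alpha^*(x)$ has the following properties. (i) For every $0<\lambda\le2$ put $E(x)=2\beta V(x)$, $R_1(x)=\frac{\vartheta^2}{\kappa}R(x)$, $R_2(x)=\frac1\kappa R(x)I$, $\gamma_0(s)=\beta\lambda\gamma(s/\lambda)$ and $l(x)=\bar l(x)-\frac1\kappa h(x)^TR(x)h(x)$, where $\bar l(0)=0$ and, for $x\ne0$, $$\bar l(x)=-2\beta\big(L_{\tilde f}V+L_{G_1}V\,\alpha(x)\big)+\beta(2-\lambda)\ell_\gamma(2|L_{G_2}V|)-\beta(\beta-2)L_{G_1}V\,\alpha(x).$$ Then $E$ and $l$ are positive definite and radially unbounded, $R_1(x)>0$, $R_2(x)=R_2(x)^T>0$, and $\gamma_0$ and $\gamma_0'$ are of class $K_\infty$. The law $\alpha^*$ is continuous away from the origin, vanishes at the origin and is admissible. For every $x(0)$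 it minimizes $J$ over all admissible laws, with minimum value $J=2\beta V(x(0))$, and under $\alpha^*$ the limit in $J$ always exists in $[-\infty,\infty]$. (ii) The closed loop is input-to-state stable: there are a $KL$-function $\sigma$ and a $K$-function $g$ such that every solution with $w\in L_\infty$ satisfies $|x(t)|\le\sigma(|x(0)|,t)+g(\|w_t\|_\infty)$ for all $t>0$ in its interval of existence, where $w_t$ is the truncation of $w$ to $[0,t]$ (in particular no such solution escapes in finite time). (iii) If $\gamma(s)=s^2/\mu$ for some $\mu>0$, the closed loop is finite-gain $L_2$ stable: there are $\kappa_L\ge0$ and, for each $x(0)$, $c_0\ge0$ such that every solution with $w\in L_2$ satisfies $\|y\|_2\le\kappa_L\|w\|_2+c_0$, the norms being taken over the interval on which the solution is defined. -/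

import Mathlib

open Set Filter Topology MeasureTheory

noncomputable section

namespace InverseOptimal

/-- Real `n`-space with the Euclidean norm. -/
abbrev E (n : ℕ) : Type := EuclideanSpace ℝ (Fin n)

/-! ### Dilations and homogeneity -/

/-- The dilation `(x₁, …, xₙ) ↦ (ε ^ r₁ x₁, …, ε ^ rₙ xₙ)`. -/
def dilation {n : ℕ} (r : Fin n → ℝ) (ε : ℝ) (x : E n) : E n :=
  WithLp.toLp 2 (fun i => ε ^ r i * x i)

/-- A scalar function that is homogeneous of degree `m` for the dilation with weights `r`. -/
def IsHomogeneousFn {n : ℕ} (r : Fin n → ℝ) (m : ℝ) (F : E n → ℝ) : Prop :=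
  ∀ ε : ℝ, 0 < ε → ∀ x : E n, F (dilation r ε x) = ε ^ m * F x

/-- A vector field that is homogeneous of degree `m` for the dilation with weights `r`. -/
def IsHomogeneousField {n : ℕ} (r : Fin n → ℝ) (m : ℝ) (φ : E n → E n) : Prop :=
  ∀ ε : ℝ, 0 < ε → ∀ (x : E n) (i : Fin n), φ (dilation r ε x) i = ε ^ (m + r i) * φ x i

/-- Positive definite: zero at the origin and positive elsewhere. -/
def IsPosDef {n : ℕ} (F : E n → ℝ) : Prop :=
  F 0 = 0 ∧ ∀ x : E n, x ≠ 0 → 0 < F x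

/-- Radially unbounded: `F x → ∞` as `|x| → ∞`. -/
def IsRadiallyUnbounded {n : ℕ} (F : E n → ℝ) : Prop :=
  Tendsto F (cocompact (E n)) atTop

/-! ### Comparison functions and the Legendre–Fenchel transform

Functions on `[0, ∞)` are represented by functions on `ℝ` of which only the values on `[0, ∞)`
are used. -/

/-- Class `K`. -/
def ClassK (g : ℝ → ℝ) : Prop :=
  g 0 = 0 ∧ ContinuousOn g (Ici 0) ∧ StrictMonoOn g (Ici 0)

/-- Class `K∞`. -/
def ClassKInf (g : ℝ → ℝ) : Prop :=
  ClassK g ∧ Tendsto g atTop atTop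

/-- Class `KL`. -/
def ClassKL (σ : ℝ → ℝ → ℝ) : Prop :=
  (∀ t : ℝ, 0 ≤ t → ClassK (fun s => σ s t)) ∧
    ∀ s : ℝ, 0 ≤ s → AntitoneOn (σ s) (Ici 0) ∧ Tendsto (σ s) atTop (𝓝 0)

/-- The derivative on `[0, ∞)` (one-sided at `0`). -/
def derivHalf (g : ℝ → ℝ) (s : ℝ) : ℝ := derivWithin g (Ici 0) s

/-- A `K∞` function whose derivative exists and is also of class `K∞`. -/
def ClassKInfDeriv (g : ℝ → ℝ) : Prop :=
  ClassKInf g ∧ DifferentiableOn ℝ g (Ici 0) ∧ ClassKInf (derivHalf g)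

/-- The inverse `(g')⁻¹` of the derivative, as a function on `[0, ∞)`. -/
def derivInv (g : ℝ → ℝ) (s : ℝ) : ℝ := Function.invFunOn (derivHalf g) (Ici 0) s

/-- The Legendre–Fenchel transform `ℓ_g(s) = s (g')⁻¹(s) - g((g')⁻¹(s))`, for `s ≥ 0`. -/
def legendre (g : ℝ → ℝ) (s : ℝ) : ℝ := s * derivInv g s - g (derivInv g s)

/-! ### The control system -/

/-- The data of `ẋ = f(x) + G₁(x) u + G₂(x) w`, `y = h(x) + d u`, with scalar control `u`;
`G₂ j` is the `j`-th column of the disturbance matrix `G₂`. -/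
structure ControlSystem (n ξ l : ℕ) where
  f : E n → E n
  G₁ : E n → E n
  G₂ : Fin ξ → E n → E n
  h : E n → E l
  d : E l

/-- The right-hand side `f(x) + G₁(x) u + G₂(x) w`. -/
def ControlSystem.rhs {n ξ l : ℕ} (S : ControlSystem n ξ l) (x : E n) (u : ℝ) (w : E ξ) : E n :=
  S.f x + u • S.G₁ x + ∑ j, w j • S.G₂ j x

/-- The output `h(x) + d u`. -/
def ControlSystem.output {n ξ l : ℕ} (S : ControlSystem n ξ l) (x : E n) (u : ℝ) : E l :=
  S.h x + u • S.d

/-- The standing assumptions on the system: weights `r`, least weight `r₀`, degree `k > -r₀` of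
`f`, degree `-r₀` of `G₁` and `G₂`, degree `k + r₀` of `h`, regularity, and
`hᵀ d = 0`, `dᵀ d = ϑ²`. -/
structure IsHomogeneousSystem {n ξ l : ℕ} (S : ControlSystem n ξ l) (r : Fin n → ℝ)
    (r₀ k ϑ : ℝ) : Prop where
  r_pos : ∀ i, 0 < r i
  r₀_least : IsLeast (Set.range r) r₀
  k_gt : -r₀ < k
  f_cont : Continuous S.f
  f_diff : ContDiffOn ℝ 1 S.f {0}ᶜ
  f_zero : S.f 0 = 0
  f_hom : IsHomogeneousField r k S.f
  G₁_cont : Continuous S.G₁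
  G₁_diff : ContDiffOn ℝ 1 S.G₁ {0}ᶜ
  G₁_hom : IsHomogeneousField r (-r₀) S.G₁
  G₂_cont : ∀ j, Continuous (S.G₂ j)
  G₂_diff : ∀ j, ContDiffOn ℝ 1 (S.G₂ j) {0}ᶜ
  G₂_hom : ∀ j, IsHomogeneousField r (-r₀) (S.G₂ j)
  h_cont : Continuous S.h
  h_diff : ContDiffOn ℝ 1 S.h {0}ᶜ
  h_zero : S.h 0 = 0
  h_hom : ∀ i, IsHomogeneousFn r (k + r₀) (fun x => S.h x i)
  ϑ_pos : 0 < ϑ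
  h_orth : ∀ x, inner ℝ (S.h x) S.d = 0
  d_norm : inner ℝ S.d S.d = ϑ ^ 2

/-! ### Lie derivatives, the auxiliary system and the control laws -/

/-- The Lie derivative `L_φ V(x) = (∂V/∂x) φ(x)`. For a positive definite `V` that is `C¹` away
from the origin its value at `0` is `0`, whether or not `V` is differentiable there (a positive
definite function that is differentiable at `0` has zero derivative at its minimum `0`, and
otherwise `fderiv` is `0`); for the homogeneous functions considered here this is the continuous
extension to the origin. -/
def lieDeriv {n : ℕ} (V : E n → ℝ) (φ : E n → E n) (x : E n) : ℝ := fderiv ℝ V x (φ x)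

/-- The (transposed) row vector `L_{G₂} V(x)`. -/
def lieG₂ {n ξ l : ℕ} (S : ControlSystem n ξ l) (V : E n → ℝ) (x : E n) : E ξ :=
  WithLp.toLp 2 (fun j => lieDeriv V (S.G₂ j) x)

open Classical in
/-- The drift of the auxiliary system: `f̃(0) = f(0)` and
`f̃(x) = f(x) + G₂(x) ℓ_γ(2|L_{G₂}V|) (L_{G₂}V)ᵀ / |L_{G₂}V|²` for `x ≠ 0`; where
`L_{G₂}V(x) = 0` the second term is zero. -/
def auxDrift {n ξ l : ℕ} (S : ControlSystem n ξ l) (V : E n → ℝ) (γ : ℝ → ℝ) (x : E n) : E n :=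
  if x = 0 then S.f 0
  else S.f x + ∑ j, (legendre γ (2 * ‖lieG₂ S V x‖) / ‖lieG₂ S V x‖ ^ 2 * lieG₂ S V x j) •
    S.G₂ j x

/-- The control law `α(x) = -(κ / 2ϑ²) R(x)⁻¹ L_{G₁}V(x)`. -/
def baseLaw {n ξ l : ℕ} (S : ControlSystem n ξ l) (V R : E n → ℝ) (ϑ κ : ℝ) (x : E n) : ℝ :=
  -(κ / (2 * ϑ ^ 2)) * (R x)⁻¹ * lieDeriv V S.G₁ x

/-- The control law `α*(x) = -(β κ / 2ϑ²) R(x)⁻¹ L_{G₁}V(x)`. -/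
def optLaw {n ξ l : ℕ} (S : ControlSystem n ξ l) (V R : E n → ℝ) (ϑ κ β : ℝ) (x : E n) : ℝ :=
  -(β * κ / (2 * ϑ ^ 2)) * (R x)⁻¹ * lieDeriv V S.G₁ x

/-- `α` asymptotically stabilizes the auxiliary system `ẋ = f̃(x) + G₁(x) u` at the origin with
respect to the Lyapunov function candidate `V`: the derivative of `V` along
`ẋ = f̃(x) + G₁(x) α(x)` is negative away from the origin. -/
def StabilizesAux {n ξ l : ℕ} (S : ControlSystem n ξ l) (V : E n → ℝ) (γ : ℝ → ℝ)
    (α : E n → ℝ) : Prop :=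
  ∀ x : E n, x ≠ 0 → lieDeriv V (fun z => auxDrift S V γ z + α z • S.G₁ z) x < 0

open Classical in
/-- `H_κ(0) = 0` and `H_κ(x) = -κ [L_f̃ V(x) + L_{G₁}V(x) α(x)] - h(x)ᵀ R(x) h(x)`, `x ≠ 0`. -/
def Hκ {n ξ l : ℕ} (S : ControlSystem n ξ l) (V : E n → ℝ) (γ : ℝ → ℝ) (R : E n → ℝ)
    (ϑ κ : ℝ) (x : E n) : ℝ :=
  if x = 0 then 0
  else -κ * (lieDeriv V (auxDrift S V γ) x + lieDeriv V S.G₁ x * baseLaw S V R ϑ κ x)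
    - R x * ‖S.h x‖ ^ 2

/-! ### Solutions -/

/-- `x` is a (Carathéodory) solution on `[0, T)`, `0 < T ≤ ∞`, with initial state `x₀`, control
signal `u` and disturbance signal `w`, both locally square integrable on `[0, T)`. -/
structure IsSolution {n ξ l : ℕ} (S : ControlSystem n ξ l) (T : EReal) (x₀ : E n)
    (u : ℝ → ℝ) (w : ℝ → E ξ) (x : ℝ → E n) : Prop where
  T_pos : 0 < T
  u_mem : ∀ t : ℝ, 0 ≤ t → (t : EReal) < T → MemLp u 2 (volume.restrict (Ioc 0 t))
  w_mem : ∀ t : ℝ, 0 ≤ t → (t : EReal) < T → MemLp w 2 (volume.restrict (Ioc 0 t))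
  cont : ContinuousOn x {t : ℝ | 0 ≤ t ∧ (t : EReal) < T}
  eqn : ∀ t : ℝ, 0 ≤ t → (t : EReal) < T →
    x t = x₀ + ∫ s in (0 : ℝ)..t, S.rhs (x s) (u s) (w s)

open Classical in
/-- The filter `t → T⁻`, which is `t → ∞` if `T = ∞`. -/
def toEnd (T : EReal) : Filter ℝ := if T = ⊤ then atTop else 𝓝[<] T.toReal

/-- A solution on its full interval of existence `[0, T)`: either `T = ∞`, or the state escapes
to infinity at the finite time `T`. -/
def IsMaximalSolution {n ξ l : ℕ} (S : ControlSystem n ξ l) (T : EReal) (x₀ : E n)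
    (u : ℝ → ℝ) (w : ℝ → E ξ) (x : ℝ → E n) : Prop :=
  IsSolution S T x₀ u w x ∧ (T = ⊤ ∨ Tendsto (fun t => ‖x t‖) (toEnd T) atTop)

/-! ### The cost functional -/

/-- The penalties: terminal `Et`, state `l`, control `R₁` (scalar control), output `R₂`,
disturbance `γ₀`. -/
structure Weights (n l : ℕ) where
  Et : E n → ℝ
  lw : E n → ℝ
  R₁ : E n → ℝ
  R₂ : E n → Matrix (Fin l) (Fin l) ℝ
  γ₀ : ℝ → ℝ

/-- The requirements on the penalties. -/
structure Weights.IsMeaningful {n l : ℕ} (P : Weights n l) : Prop where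
  Et_pos : IsPosDef P.Et
  Et_unb : IsRadiallyUnbounded P.Et
  lw_pos : IsPosDef P.lw
  lw_unb : IsRadiallyUnbounded P.lw
  R₁_pos : ∀ x, 0 < P.R₁ x
  R₂_pos : ∀ x, (P.R₂ x).PosDef
  γ₀_cls : ClassKInfDeriv P.γ₀

/-- The integrand `l(x) + uᵀ R₁(x) u + yᵀ R₂(x) y - γ₀(|w|)`. -/
def runningCost {n ξ l : ℕ} (S : ControlSystem n ξ l) (P : Weights n l) (x : E n) (u : ℝ)
    (w : E ξ) : ℝ :=
  P.lw x + P.R₁ x * u ^ 2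
    + (fun i => S.output x u i) ⬝ᵥ (P.R₂ x).mulVec (fun i => S.output x u i) - P.γ₀ ‖w‖

/-- `E(x(t)) + ∫₀ᵗ (l(x) + uᵀ R₁(x) u + yᵀ R₂(x) y - γ₀(|w|)) dτ`. -/
def costUpTo {n ξ l : ℕ} (S : ControlSystem n ξ l) (P : Weights n l) (u : ℝ → ℝ)
    (w : ℝ → E ξ) (x : ℝ → E n) (t : ℝ) : ℝ :=
  P.Et (x t) + ∫ s in (0 : ℝ)..t, runningCost S P (x s) (u s) (w s)

/-- `(T, w, x)` is a possible disturbance and a corresponding motion from `x₀` under the control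
law `u = a(t, x)`. -/
def IsMotion {n ξ l : ℕ} (S : ControlSystem n ξ l) (P : Weights n l) (a : ℝ → E n → ℝ)
    (x₀ : E n) (T : EReal) (w : ℝ → E ξ) (x : ℝ → E n) : Prop :=
  IsMaximalSolution S T x₀ (fun t => a t (x t)) w x ∧
    ∀ t : ℝ, 0 ≤ t → (t : EReal) < T → IntervalIntegrable (fun s => P.γ₀ ‖w s‖) volume 0 t

/-- The worst-case cost `J(a)` from `x₀` of the control law `u = a(t, x)`: the supremum over all
disturbances and motions of the limit of `costUpTo` at the end of the interval of existence (at
`t → ∞` unless the motion escapes in finite time). The upper limit makes this defined for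
every control law. -/
def worstCost {n ξ l : ℕ} (S : ControlSystem n ξ l) (P : Weights n l) (a : ℝ → E n → ℝ)
    (x₀ : E n) : EReal :=
  sSup {c : EReal | ∃ (T : EReal) (w : ℝ → E ξ) (x : ℝ → E n), IsMotion S P a x₀ T w x ∧
    c = limsup (fun t => (costUpTo S P (fun s => a s (x s)) w x t : EReal)) (toEnd T)}

/-- Well-posedness of a (possibly time-varying) control law `u = a(t, x)` from `x₀`: against every
continuous disturbance law `w = ω(x)` with `ω(0) = 0` the closed loop has a solution. -/
def IsAdmissible {n ξ l : ℕ} (S : ControlSystem n ξ l) (a : ℝ → E n → ℝ) (x₀ : E n) : Prop :=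
  ∀ ω : E n → E ξ, Continuous ω → ω 0 = 0 →
    ∃ (T : EReal) (x : ℝ → E n),
      IsMaximalSolution S T x₀ (fun t => a t (x t)) (fun t => ω (x t)) x

/-- The state feedback `α` minimizes the worst-case cost, for every initial state `x₀`, over all
well-posed control laws, with minimum value `m x₀`; moreover under `α` the upper limit in the
cost is always a limit. -/
structure IsMinimizer {n ξ l : ℕ} (S : ControlSystem n ξ l) (P : Weights n l) (α : E n → ℝ)
    (m : E n → ℝ) : Prop where
  cont : ContinuousOn α {0}ᶜ
  zero : α 0 = 0
  admissible : ∀ x₀, IsAdmissible S (fun _ => α) x₀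
  limit : ∀ (x₀ : E n) (T : EReal) (w : ℝ → E ξ) (x : ℝ → E n),
    IsMotion S P (fun _ => α) x₀ T w x →
      ∃ c : EReal, Tendsto (fun t => (costUpTo S P (fun s => α (x s)) w x t : EReal))
        (toEnd T) (𝓝 c)
  value : ∀ x₀, worstCost S P (fun _ => α) x₀ = (m x₀ : EReal)
  minimal : ∀ (x₀ : E n) (a : ℝ → E n → ℝ), IsAdmissible S a x₀ →
    worstCost S P (fun _ => α) x₀ ≤ worstCost S P a x₀

open Classical in
/-- `l̄(0) = 0` and
`l̄(x) = -2β (L_f̃ V + L_{G₁}V α(x)) + β (2 - λ) ℓ_γ(2|L_{G₂}V|) - β (β - 2) L_{G₁}V α(x)`,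
`x ≠ 0`. -/
def lBar {n ξ l : ℕ} (S : ControlSystem n ξ l) (V : E n → ℝ) (γ : ℝ → ℝ) (R : E n → ℝ)
    (ϑ κ β lam : ℝ) (x : E n) : ℝ :=
  if x = 0 then 0
  else -2 * β * (lieDeriv V (auxDrift S V γ) x + lieDeriv V S.G₁ x * baseLaw S V R ϑ κ x)
    + β * (2 - lam) * legendre γ (2 * ‖lieG₂ S V x‖)
    - β * (β - 2) * (lieDeriv V S.G₁ x * baseLaw S V R ϑ κ x)

/-- The explicit penalties: `E = 2βV`, `l = l̄ - hᵀ R h / κ`, `R₁ = (ϑ²/κ) R`,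
`R₂ = (1/κ) R` (times the identity), `γ₀(s) = β λ γ(s/λ)`. -/
def explicitWeights {n ξ l : ℕ} (S : ControlSystem n ξ l) (V : E n → ℝ) (γ : ℝ → ℝ)
    (R : E n → ℝ) (ϑ κ β lam : ℝ) : Weights n l where
  Et x := 2 * β * V x
  lw x := lBar S V γ R ϑ κ β lam x - R x * ‖S.h x‖ ^ 2 / κ
  R₁ x := ϑ ^ 2 / κ * R x
  R₂ x := (1 / κ * R x) • (1 : Matrix (Fin l) (Fin l) ℝ)
  γ₀ s := β * lam * γ (s / lam)

/-! ### Stability notions for the closed loop `u = α(x)` -/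

/-- Input-to-state stability of the closed loop. The estimate is required of every solution, on
whatever interval `[0, T)` it is defined; in particular no solution with bounded disturbance
escapes in finite time. -/
def IsISS {n ξ l : ℕ} (S : ControlSystem n ξ l) (α : E n → ℝ) : Prop :=
  ∃ σ : ℝ → ℝ → ℝ, ClassKL σ ∧ ∃ g : ℝ → ℝ, ClassK g ∧
    ∀ (x₀ : E n) (w : ℝ → E ξ), MemLp w ⊤ (volume.restrict (Ioi 0)) →
      ∀ (T : EReal) (x : ℝ → E n), IsSolution S T x₀ (fun t => α (x t)) w x →
        ∀ t : ℝ, 0 < t → (t : EReal) < T →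
          ‖x t‖ ≤ σ ‖x₀‖ t + g (eLpNorm w ⊤ (volume.restrict (Ioc 0 t))).toReal

/-- Finite-gain `L₂` stability of the closed loop, `‖y‖₂ ≤ κ_L ‖w‖₂ + c₀`, where the gain `κ_L`
is uniform and the offset `c₀` depends only on the initial state. The norms are taken over the
interval `[0, T)` on which the solution is defined; `T = ∞` is the usual estimate. -/
def IsFiniteGainL2 {n ξ l : ℕ} (S : ControlSystem n ξ l) (α : E n → ℝ) : Prop :=
  ∃ κL : ℝ, 0 ≤ κL ∧ ∀ x₀ : E n, ∃ c₀ : ℝ, 0 ≤ c₀ ∧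
    ∀ (T : EReal) (w : ℝ → E ξ) (x : ℝ → E n),
      IsSolution S T x₀ (fun t => α (x t)) w x →
      MemLp w 2 (volume.restrict {t : ℝ | 0 ≤ t ∧ (t : EReal) < T}) →
        eLpNorm (fun t => S.output (x t) (α (x t))) 2
            (volume.restrict {t : ℝ | 0 ≤ t ∧ (t : EReal) < T})
          ≤ ENNReal.ofReal κL *
              eLpNorm w 2 (volume.restrict {t : ℝ | 0 ≤ t ∧ (t : EReal) < T})
            + ENNReal.ofReal c₀

end InverseOptimal

end

open InverseOptimal

namespace InverseOptimal

/-! ### Homogeneous functions -/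

section Homogeneous

variable {n : ℕ} {r : Fin n → ℝ}

/-! The homogeneity of `legendre γ` leaves no freedom in `γ`: Fenchel–Young duality turns a
transform of degree two into a quadratic, so `γ s = s ^ 2 / μ` and `legendre γ (2 * s) = μ * s ^ 2`
for some `μ > 0` (`exists_eq_sq_of_legendre`). From then on the game is linear-quadratic in `u` and
`w`.

Optimality is a completion of squares. With these penalties the running cost equals `saddleGap`
minus `2 * β` times the derivative of `V` along the system (`runningCost_eq`), and `saddleGap` is a
positive multiple of a square in `u - α*` minus a positive multiple of a square in `w - λμ
(L_{G₂}V)ᵀ`. Integrating, the cost up to time `t` is `2 β V(x₀)` plus the integral of `saddleGap`.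
Under `α*` the gap is nonpositive, so the cost is nonincreasing in `t`: its limit exists and is at
most `2 β V(x₀)`. Against the disturbance law `w = λμ (L_{G₂}V)ᵀ` the gap is nonnegative for every
control, so no admissible law costs less. That disturbance law is continuous and vanishes at the
origin, so admissibility provides a motion under it.

Everything else is governed by `auxDecay`, the derivative of `V` along the stabilized auxiliary
system. It is homogeneous of degree `2k + 2r₀`, as are `R⁻¹ (L_{G₁}V)²`, `|L_{G₂}V|²` and `R |h|²`;
compactness of the homogeneous unit sphere makes such functions comparable. This gives the gain
threshold, the positivity and radial unboundedness of the state penalty, and a bound of `|y|²` by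
the decay. Young's inequality gives `V' ≤ auxDecay + |w|² / (4μ)` along the closed loop; integrated,
it yields the `L₂` gain, and combined with `auxDecay ≤ -2 a V ^ p` it yields input-to-state
stability.

Two analytic points need care. `V` need not be differentiable at the origin, so the chain rule along
Carathéodory solutions is proved for a cut-off `V` and passed to the limit. The closed loop is only
continuous, so solutions come from Peano's theorem, with a time change to reach either all times or
an escape. -/

@[simp] lemma dilation_apply (r : Fin n → ℝ) (ε : ℝ) (x : E n) (i : Fin n) :
    dilation r ε x i = ε ^ r i * x i := rfl

@[simp] lemma dilation_zero (r : Fin n → ℝ) (ε : ℝ) : dilation r ε (0 : E n) = 0 := by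
  ext i; simp

/-- The dilation as a continuous linear map. -/
noncomputable def dilationCLM (r : Fin n → ℝ) (ε : ℝ) : E n →L[ℝ] E n :=
  LinearMap.toContinuousLinearMap
    { toFun := dilation r ε
      map_add' := fun x y => by ext i; simp [mul_add]
      map_smul' := fun c x => by ext i; simp; ring }

@[simp] lemma dilationCLM_apply (r : Fin n → ℝ) (ε : ℝ) (x : E n) :
    dilationCLM r ε x = dilation r ε x := rfl

/-- The homogeneous norm `∑ᵢ |xᵢ| ^ (1 / rᵢ)`. -/
noncomputable def homNorm (r : Fin n → ℝ) (x : E n) : ℝ := ∑ i, |x i| ^ (1 / r i)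

lemma homNorm_nonneg (r : Fin n → ℝ) (x : E n) : 0 ≤ homNorm r x :=
  Finset.sum_nonneg fun _ _ => by positivity

lemma homNorm_pos (r : Fin n → ℝ) {x : E n} (hx : x ≠ 0) : 0 < homNorm r x := by
  obtain ⟨i, hi⟩ : ∃ i, x i ≠ 0 := by
    by_contra! h
    exact hx (by ext i; simpa using h i)
  exact Finset.sum_pos' (fun _ _ => by positivity)
    ⟨i, Finset.mem_univ i, Real.rpow_pos_of_pos (abs_pos.2 hi) _⟩

lemma continuous_homNorm (hr : ∀ i, 0 < r i) : Continuous (homNorm r) := by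
  refine continuous_finsetSum _ fun i _ => ?_
  have : Continuous fun x : E n => |x i| := by fun_prop
  exact this.rpow_const fun x => Or.inr (by have := hr i; positivity)

lemma homNorm_zero (hr : ∀ i, 0 < r i) : homNorm r (0 : E n) = 0 := by
  refine Finset.sum_eq_zero fun i _ => ?_
  have := (hr i).ne'
  simp [Real.zero_rpow, this]

lemma homNorm_dilation (hr : ∀ i, 0 < r i) {ε : ℝ} (hε : 0 < ε) (x : E n) :
    homNorm r (dilation r ε x) = ε * homNorm r x := by
  rw [homNorm, homNorm, Finset.mul_sum]
  refine Finset.sum_congr rfl fun i _ => ?_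
  rw [dilation_apply, abs_mul, abs_of_pos (Real.rpow_pos_of_pos hε _),
    Real.mul_rpow (by positivity) (abs_nonneg _), ← Real.rpow_mul hε.le,
    mul_one_div_cancel (hr i).ne', Real.rpow_one]

lemma dilation_dilation_inv {ε : ℝ} (hε : 0 < ε) (x : E n) :
    dilation r ε (dilation r ε⁻¹ x) = x := by
  ext i
  simp only [dilation_apply]
  rw [← mul_assoc, ← Real.mul_rpow hε.le (by positivity), mul_inv_cancel₀ hε.ne',
    Real.one_rpow, one_mul]

lemma abs_apply_le_homNorm_rpow (hr : ∀ i, 0 < r i) (x : E n) (i : Fin n) :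
    |x i| ≤ homNorm r x ^ r i := by
  have h : |x i| ^ (1 / r i) ≤ homNorm r x :=
    Finset.single_le_sum (f := fun i => |x i| ^ (1 / r i)) (fun _ _ => by positivity)
      (Finset.mem_univ i)
  calc |x i| = (|x i| ^ (1 / r i)) ^ r i := by
        rw [← Real.rpow_mul (abs_nonneg _), one_div_mul_cancel (hr i).ne', Real.rpow_one]
    _ ≤ _ := Real.rpow_le_rpow (by positivity) h (hr i).le

lemma norm_le_sum_homNorm_rpow (hr : ∀ i, 0 < r i) (x : E n) :
    ‖x‖ ≤ ∑ i, homNorm r x ^ r i := by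
  calc ‖x‖ = ‖∑ i, x i • EuclideanSpace.single i (1 : ℝ)‖ := by
        congr 1
        ext j
        simp [Finset.sum_apply, Pi.single_apply]
    _ ≤ ∑ i, ‖x i • EuclideanSpace.single i (1 : ℝ)‖ := norm_sum_le _ _
    _ ≤ _ := Finset.sum_le_sum fun i _ => by
        simpa [norm_smul] using abs_apply_le_homNorm_rpow hr x i

lemma homNorm_le_sum_norm_rpow (hr : ∀ i, 0 < r i) (x : E n) :
    homNorm r x ≤ ∑ i, ‖x‖ ^ (1 / r i) :=
  Finset.sum_le_sum fun i _ => Real.rpow_le_rpow (abs_nonneg _)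
    (by simpa using PiLp.norm_apply_le x i) (by have := hr i; positivity)

lemma isCompact_homNorm_eq_one (hr : ∀ i, 0 < r i) : IsCompact {x : E n | homNorm r x = 1} := by
  refine Metric.isCompact_of_isClosed_isBounded
    (isClosed_eq (continuous_homNorm hr) continuous_const) ?_
  refine (Metric.isBounded_closedBall (x := (0 : E n)) (r := ∑ _i : Fin n, (1 : ℝ))).subset ?_
  intro x (hx : homNorm r x = 1)
  have := norm_le_sum_homNorm_rpow hr x
  simpa [hx] using this

lemma homNorm_normalize (hr : ∀ i, 0 < r i) {x : E n} (hx : x ≠ 0) :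
    homNorm r (dilation r (homNorm r x)⁻¹ x) = 1 := by
  have := homNorm_pos r hx
  rw [homNorm_dilation hr (by positivity), inv_mul_cancel₀ this.ne']

lemma ne_zero_of_homNorm_eq_one (hr : ∀ i, 0 < r i) {x : E n} (hx : homNorm r x = 1) :
    x ≠ 0 := by
  rintro rfl
  simp [homNorm_zero hr] at hx

/-- The dilation by `(homNorm r x)⁻¹` moves `x` to the compact set `homNorm r = 1`, so a homogeneous
function is determined off the origin by its values there. The comparison estimates below all rest
on this. -/
lemma IsHomogeneousFn.eq_rpow_mul {m : ℝ} {F : E n → ℝ} (hF : IsHomogeneousFn r m F)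
    {x : E n} (hx : x ≠ 0) :
    F x = homNorm r x ^ m * F (dilation r (homNorm r x)⁻¹ x) := by
  have h := homNorm_pos r hx
  rw [← hF _ h, dilation_dilation_inv h]

lemma IsHomogeneousFn.exists_abs_le {m : ℝ} {F : E n → ℝ} (hF : IsHomogeneousFn r m F)
    (hr : ∀ i, 0 < r i) (hc : ContinuousOn F {0}ᶜ) :
    ∃ C, 0 < C ∧ ∀ x ≠ 0, |F x| ≤ C * homNorm r x ^ m := by
  obtain ⟨C, hC⟩ := (isCompact_homNorm_eq_one hr).exists_bound_of_continuousOn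
    (hc.mono fun x hx => ne_zero_of_homNorm_eq_one hr hx)
  refine ⟨max C 1, by positivity, fun x hx => ?_⟩
  have h := homNorm_pos r hx
  rw [hF.eq_rpow_mul hx, abs_mul, abs_of_pos (Real.rpow_pos_of_pos h _), mul_comm]
  gcongr
  exact (hC _ (homNorm_normalize hr hx)).trans (le_max_left _ _)

lemma IsHomogeneousFn.exists_le {m : ℝ} {F : E n → ℝ} (hF : IsHomogeneousFn r m F)
    (hr : ∀ i, 0 < r i) (hc : ContinuousOn F {0}ᶜ) (hpos : ∀ x ≠ 0, 0 < F x) :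
    ∃ c, 0 < c ∧ ∀ x ≠ 0, c * homNorm r x ^ m ≤ F x := by
  have hK : ∃ c, 0 < c ∧ ∀ x : E n, homNorm r x = 1 → c ≤ F x := by
    rcases Set.eq_empty_or_nonempty {x : E n | homNorm r x = 1} with he | hne
    · exact ⟨1, one_pos, fun x hx => absurd hx (by
        have : x ∉ {x : E n | homNorm r x = 1} := by simp [he]
        exact this)⟩
    · obtain ⟨y, hy, hmin⟩ := (isCompact_homNorm_eq_one hr).exists_isMinOn hne
        (hc.mono fun x hx => ne_zero_of_homNorm_eq_one hr hx)
      exact ⟨F y, hpos y (ne_zero_of_homNorm_eq_one hr hy), fun x hx => hmin hx⟩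
  obtain ⟨c, hc0, hcF⟩ := hK
  refine ⟨c, hc0, fun x hx => ?_⟩
  have h := homNorm_pos r hx
  rw [hF.eq_rpow_mul hx, mul_comm]
  gcongr
  exact hcF _ (homNorm_normalize hr hx)

/-- A positive degree forces continuity at the origin, because the bound `C * homNorm r x ^ m` tends
to zero. Hence Lie derivatives and control laws known to be continuous only away from `0` are
continuous everywhere. -/
lemma IsHomogeneousFn.continuous {m : ℝ} {F : E n → ℝ} (hF : IsHomogeneousFn r m F)
    (hr : ∀ i, 0 < r i) (hm : 0 < m) (hc : ContinuousOn F {0}ᶜ) (h0 : F 0 = 0) :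
    Continuous F := by
  obtain ⟨C, hC, hb⟩ := hF.exists_abs_le hr hc
  refine continuous_iff_continuousAt.2 fun x => ?_
  rcases eq_or_ne x 0 with rfl | hx
  · have hcont : Continuous fun x : E n => C * homNorm r x ^ m :=
      continuous_const.mul ((continuous_homNorm hr).rpow_const fun _ => Or.inr hm.le)
    have ht : Tendsto (fun x : E n => C * homNorm r x ^ m) (𝓝 0) (𝓝 0) := by
      simpa [homNorm_zero hr, Real.zero_rpow hm.ne'] using hcont.tendsto 0
    rw [ContinuousAt, h0]
    refine squeeze_zero_norm (fun y => ?_) ht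
    rcases eq_or_ne y 0 with rfl | hy
    · simp [h0, homNorm_zero hr, Real.zero_rpow hm.ne']
    · exact hb y hy
  · exact hc.continuousAt (isOpen_compl_singleton.mem_nhds hx)

lemma tendsto_homNorm_cocompact (hr : ∀ i, 0 < r i) :
    Tendsto (homNorm r) (cocompact (E n)) atTop := by
  have h1 : Tendsto (fun x : E n => ‖x‖) (cocompact (E n)) atTop := tendsto_norm_cocompact_atTop
  rw [tendsto_atTop] at h1 ⊢
  intro b
  filter_upwards [h1 (∑ i, (max b 0) ^ r i + 1)] with x hx
  by_contra! hb
  have h2 := norm_le_sum_homNorm_rpow hr x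
  have h3 : ∑ i, homNorm r x ^ r i ≤ ∑ i, (max b 0) ^ r i :=
    Finset.sum_le_sum fun i _ => Real.rpow_le_rpow (homNorm_nonneg r x)
      (hb.le.trans (le_max_left _ _)) (hr i).le
  linarith

lemma IsHomogeneousFn.isRadiallyUnbounded {m : ℝ} {F : E n → ℝ} (hF : IsHomogeneousFn r m F)
    (hr : ∀ i, 0 < r i) (hm : 0 < m) (hc : ContinuousOn F {0}ᶜ) (hpos : IsPosDef F) :
    IsRadiallyUnbounded F := by
  obtain ⟨c, hc0, hb⟩ := hF.exists_le hr hc hpos.2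
  have h1 : Tendsto (fun x : E n => c * homNorm r x ^ m) (cocompact (E n)) atTop :=
    ((tendsto_rpow_atTop hm).comp (tendsto_homNorm_cocompact hr)).const_mul_atTop hc0
  refine tendsto_atTop_mono (fun x => ?_) h1
  rcases eq_or_ne x 0 with rfl | hx
  · simp [homNorm_zero hr, Real.zero_rpow hm.ne', hpos.1]
  · exact hb x hx

lemma IsHomogeneousFn.add {m : ℝ} {F G : E n → ℝ} (hF : IsHomogeneousFn r m F)
    (hG : IsHomogeneousFn r m G) : IsHomogeneousFn r m (fun x => F x + G x) := by
  intro ε hε x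
  simp only [hF ε hε x, hG ε hε x]; ring

lemma IsHomogeneousFn.sub {m : ℝ} {F G : E n → ℝ} (hF : IsHomogeneousFn r m F)
    (hG : IsHomogeneousFn r m G) : IsHomogeneousFn r m (fun x => F x - G x) := by
  intro ε hε x
  simp only [hF ε hε x, hG ε hε x]; ring

lemma IsHomogeneousFn.neg {m : ℝ} {F : E n → ℝ} (hF : IsHomogeneousFn r m F) :
    IsHomogeneousFn r m (fun x => -F x) := by
  intro ε hε x
  simp only [hF ε hε x]; ring

lemma IsHomogeneousFn.const_mul {m : ℝ} {F : E n → ℝ} (hF : IsHomogeneousFn r m F) (c : ℝ) :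
    IsHomogeneousFn r m (fun x => c * F x) := by
  intro ε hε x
  simp only [hF ε hε x]; ring

lemma IsHomogeneousFn.mul {m m' : ℝ} {F G : E n → ℝ} (hF : IsHomogeneousFn r m F)
    (hG : IsHomogeneousFn r m' G) : IsHomogeneousFn r (m + m') (fun x => F x * G x) := by
  intro ε hε x
  simp only [hF ε hε x, hG ε hε x, Real.rpow_add hε]; ring

lemma IsHomogeneousFn.inv {F : E n → ℝ} (hF : IsHomogeneousFn r 0 F) :
    IsHomogeneousFn r 0 (fun x => (F x)⁻¹) := by
  intro ε hε x
  simp [hF ε hε x]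

lemma IsHomogeneousFn.sum {ι : Type*} {s : Finset ι} {m : ℝ} {F : ι → E n → ℝ}
    (hF : ∀ i, IsHomogeneousFn r m (F i)) : IsHomogeneousFn r m (fun x => ∑ i ∈ s, F i x) := by
  intro ε hε x
  simp only [hF _ ε hε x, Finset.mul_sum]

lemma IsHomogeneousFn.congr_degree {m m' : ℝ} {F : E n → ℝ} (hF : IsHomogeneousFn r m F)
    (h : m = m') : IsHomogeneousFn r m' F := h ▸ hF

end Homogeneous

/-! ### Lie derivatives -/

section Lie

variable {n : ℕ} {r : Fin n → ℝ} {V : E n → ℝ}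

/-- The origin is a minimum; if `V` is not differentiable there, `fderiv` is zero by convention. Lie
derivatives therefore vanish at `0` in either case. -/
lemma IsPosDef.fderiv_zero (hV : IsPosDef V) : fderiv ℝ V 0 = 0 := by
  refine IsLocalMin.fderiv_eq_zero (Eventually.of_forall fun x => ?_)
  rcases eq_or_ne x 0 with rfl | hx
  · exact le_rfl
  · rw [hV.1]; exact (hV.2 x hx).le

lemma IsPosDef.nonneg (hV : IsPosDef V) (x : E n) : 0 ≤ V x := by
  rcases eq_or_ne x 0 with rfl | hx
  · exact hV.1.ge
  · exact (hV.2 x hx).le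

lemma lieDeriv_zero (hV : IsPosDef V) (φ : E n → E n) : lieDeriv V φ 0 = 0 := by
  simp [lieDeriv, hV.fderiv_zero]

lemma differentiableAt_of_contDiffOn (hV : ContDiffOn ℝ 1 V {0}ᶜ) {x : E n} (hx : x ≠ 0) :
    DifferentiableAt ℝ V x :=
  (hV.differentiableOn (by norm_num)).differentiableAt (isOpen_compl_singleton.mem_nhds hx)

lemma continuousOn_lieDeriv (hV : ContDiffOn ℝ 1 V {0}ᶜ) {φ : E n → E n} (hφ : Continuous φ) :
    ContinuousOn (lieDeriv V φ) {0}ᶜ :=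
  (hV.continuousOn_fderiv_of_isOpen isOpen_compl_singleton (by norm_num)).clm_apply
    hφ.continuousOn

lemma dilation_ne_zero {ε : ℝ} (hε : 0 < ε) {x : E n} (hx : x ≠ 0) : dilation r ε x ≠ 0 := by
  intro h
  apply hx
  have := dilation_dilation_inv (r := r) (inv_pos.2 hε) x
  rw [inv_inv, h, dilation_zero] at this
  exact this.symm

/-- Differentiate both sides of `V (dilation r ε x) = ε ^ m * V x`; the dilation is linear, so it is
its own derivative. -/
lemma fderiv_dilation {m : ℝ} (hV : ContDiffOn ℝ 1 V {0}ᶜ) (hm : IsHomogeneousFn r m V)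
    {ε : ℝ} (hε : 0 < ε) {x : E n} (hx : x ≠ 0) (v : E n) :
    fderiv ℝ V (dilation r ε x) (dilation r ε v) = ε ^ m * fderiv ℝ V x v := by
  have h1 : HasFDerivAt (fun y => V (dilationCLM r ε y))
      ((fderiv ℝ V (dilation r ε x)).comp (dilationCLM r ε)) x :=
    HasFDerivAt.comp (g := V) x
      (differentiableAt_of_contDiffOn hV (dilation_ne_zero hε hx)).hasFDerivAt
      (dilationCLM r ε).hasFDerivAt
  have h2 : HasFDerivAt (fun y => V (dilationCLM r ε y)) (ε ^ m • fderiv ℝ V x) x := by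
    have : (fun y => V (dilationCLM r ε y)) = fun y => ε ^ m • V y := by
      ext y; simpa using hm ε hε y
    rw [this]
    exact (differentiableAt_of_contDiffOn hV hx).hasFDerivAt.const_smul (ε ^ m)
  simpa using congrArg (fun L => L v) (h1.unique h2)

lemma isHomogeneousFn_lieDeriv {m p : ℝ} (hpos : IsPosDef V) (hV : ContDiffOn ℝ 1 V {0}ᶜ)
    (hm : IsHomogeneousFn r m V) {φ : E n → E n} (hφ : IsHomogeneousField r p φ) :
    IsHomogeneousFn r (p + m) (lieDeriv V φ) := by
  intro ε hε x
  rcases eq_or_ne x 0 with rfl | hx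
  · simp [lieDeriv_zero hpos]
  have h : φ (dilation r ε x) = ε ^ p • dilation r ε (φ x) := by
    ext i
    simp only [hφ ε hε x i, PiLp.smul_apply, dilation_apply, smul_eq_mul, Real.rpow_add hε]
    ring
  rw [lieDeriv, h, map_smul, fderiv_dilation hV hm hε hx, smul_eq_mul, Real.rpow_add hε, lieDeriv]
  ring

end Lie

/-! ### Comparison functions and the Legendre–Fenchel transform -/

lemma ClassK.nonneg {g : ℝ → ℝ} (hg : ClassK g) {s : ℝ} (hs : 0 ≤ s) : 0 ≤ g s := by
  have := hg.2.2.monotoneOn (mem_Ici.2 le_rfl) (mem_Ici.2 hs) hs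
  rwa [hg.1] at this

lemma ClassK.pos {g : ℝ → ℝ} (hg : ClassK g) {s : ℝ} (hs : 0 < s) : 0 < g s := by
  have := hg.2.2 (mem_Ici.2 le_rfl) (mem_Ici.2 hs.le) hs
  rwa [hg.1] at this

lemma ClassK.comp {g f : ℝ → ℝ} (hg : ClassK g) (hf : ClassK f) :
    ClassK (fun s => g (f s)) :=
  ⟨by simp [hf.1, hg.1], hg.2.1.comp hf.2.1 fun _ hs => hf.nonneg hs,
    hg.2.2.comp hf.2.2 fun _ hs => hf.nonneg hs⟩

lemma ClassKInf.surjOn {g : ℝ → ℝ} (hg : ClassKInf g) : SurjOn g (Ici 0) (Ici 0) := by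
  intro y hy
  obtain ⟨b, hb0, hb⟩ := ((eventually_ge_atTop 0).and (hg.2.eventually_ge_atTop y)).exists
  obtain ⟨t, ht, rfl⟩ := intermediate_value_Icc hb0 (hg.1.2.1.mono Icc_subset_Ici_self)
    (show y ∈ Icc (g 0) (g b) from ⟨by rw [hg.1.1]; exact hy, hb⟩)
  exact ⟨t, ht.1, rfl⟩

lemma derivInv_derivHalf {g : ℝ → ℝ} (hg : ClassKInfDeriv g) {t : ℝ} (ht : 0 ≤ t) :
    derivInv g (derivHalf g t) = t :=
  hg.2.2.1.2.2.injOn.leftInvOn_invFunOn ht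

lemma exists_mean_value {g : ℝ → ℝ} (hg : ClassKInfDeriv g) {a b : ℝ} (ha : 0 ≤ a)
    (hab : a < b) : ∃ c ∈ Ioo a b, g b - g a = derivHalf g c * (b - a) := by
  obtain ⟨c, hc, h⟩ := exists_hasDerivAt_eq_slope g (derivHalf g) hab
    (hg.1.1.2.1.mono fun x hx => ha.trans hx.1) fun x hx => by
      have hx0 : Ici (0 : ℝ) ∈ 𝓝 x := Ici_mem_nhds (ha.trans_lt hx.1)
      exact (hg.2.1 x (ha.trans hx.1.le)).hasDerivWithinAt.hasDerivAt hx0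
  refine ⟨c, hc, ?_⟩
  rw [h]
  field_simp [(sub_pos.2 hab).ne']

/-- Convexity: the derivative is increasing, so by the mean value theorem the graph lies above each
of its tangents. -/
lemma tangent_le {g : ℝ → ℝ} (hg : ClassKInfDeriv g) {t a : ℝ} (ht : 0 ≤ t) (ha : 0 ≤ a) :
    derivHalf g a * (t - a) ≤ g t - g a := by
  have hmono := hg.2.2.1.2.2.monotoneOn
  rcases lt_trichotomy t a with h | rfl | h
  · obtain ⟨c, hc, h'⟩ := exists_mean_value hg ht h
    have := hmono (ht.trans hc.1.le : (0:ℝ) ≤ c) ha hc.2.le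
    nlinarith
  · simp
  · obtain ⟨c, hc, h'⟩ := exists_mean_value hg ha h
    have := hmono ha (ha.trans hc.1.le : (0:ℝ) ≤ c) hc.1.le
    nlinarith

/-- A Legendre–Fenchel transform that is homogeneous of degree two comes from a quadratic. -/
lemma exists_eq_sq_of_legendre {γ : ℝ → ℝ} (hγ : ClassKInfDeriv γ)
    (hℓ : ∀ ε : ℝ, 0 < ε → ∀ s : ℝ, 0 ≤ s →
      legendre γ (2 * ε * s) = ε ^ 2 * legendre γ (2 * s)) :
    ∃ μ : ℝ, 0 < μ ∧ (∀ s, 0 ≤ s → γ s = s ^ 2 / μ) ∧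
      ∀ s, 0 ≤ s → legendre γ (2 * s) = μ * s ^ 2 := by
  have hleg : ∀ t, 0 ≤ t → legendre γ (derivHalf γ t) = derivHalf γ t * t - γ t := fun t ht => by
    rw [legendre, derivInv_derivHalf hγ ht]
  have hsq : ∀ s, 0 ≤ s → legendre γ s = s ^ 2 * legendre γ 1 := by
    intro s hs
    rcases hs.eq_or_lt with rfl | hs
    · have := hleg 0 le_rfl
      rw [hγ.2.2.1.1, hγ.1.1.1] at this
      simpa using this
    -- Taking the scaling factor to be `s` and the argument `1 / 2` makes the right-hand transform
    -- `legendre γ 1`.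
    · have := hℓ s hs (1 / 2) (by norm_num)
      rw [show 2 * s * (1 / 2) = s by ring] at this
      rw [this]; norm_num
  set c := legendre γ 1 with hc
  -- Fenchel–Young inequality `s t - ℓ(s) ≤ γ(t)`: each slope `s` is attained by the derivative, and
  -- the tangent of that slope lies below `γ`. Equality holds at `s = γ'(t)`, which is `heq`.
  have hyoung : ∀ t s, 0 ≤ t → 0 ≤ s → s * t - s ^ 2 * c ≤ γ t := by
    intro t s ht hs
    obtain ⟨a, ha, rfl⟩ := hγ.2.2.surjOn hs
    have h1 := tangent_le hγ ht ha
    rw [← hsq _ hs, hleg a ha]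
    linarith
  have heq : ∀ t, 0 ≤ t → γ t = derivHalf γ t * t - derivHalf γ t ^ 2 * c := by
    intro t ht
    rw [← hsq _ (hγ.2.2.1.nonneg ht), hleg t ht]
    ring
  -- If `c ≤ 0`, the inequality at `t = 1` would bound every slope `s` by `γ 1`.
  have hc0 : 0 < c := by
    by_contra! h
    have h1 := hyoung 1 (γ 1 + 1) zero_le_one (by have := hγ.1.1.pos one_pos; linarith)
    nlinarith [sq_nonneg (γ 1 + 1)]
  -- The maximum of `s t - c s ^ 2` over `s` is `t ^ 2 / (4 c)`, at `s = t / (2 c)`. Young's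
  -- inequality at this `s` bounds `γ t` from below, and its equality case bounds `γ t` from above.
  refine ⟨4 * c, by positivity, fun t ht => ?_, fun s hs => ?_⟩
  · apply le_antisymm
    · rw [heq t ht, le_div_iff₀ (by positivity)]
      nlinarith [sq_nonneg (t - 2 * c * derivHalf γ t)]
    · convert! hyoung t (t / (2 * c)) ht (by positivity) using 1
      field_simp
      ring
  · rw [hsq _ (by positivity)]
    ring

lemma derivHalf_sq {a s : ℝ} {g : ℝ → ℝ} (hg : ∀ s, 0 ≤ s → g s = a * s ^ 2) (hs : 0 ≤ s) :
    derivHalf g s = 2 * a * s := by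
  have h : HasDerivWithinAt (fun s : ℝ => a * s ^ 2) (2 * a * s) (Ici 0) s := by
    convert! (((hasDerivAt_id s).pow 2).const_mul a).hasDerivWithinAt using 1
    simp; ring
  exact (h.congr (fun y hy => hg y hy) (hg s hs)).derivWithin (uniqueDiffOn_Ici 0 s hs)

lemma classKInf_of_eqOn {g g' : ℝ → ℝ} (hg : ClassKInf g) (h : EqOn g' g (Ici 0)) :
    ClassKInf g' :=
  ⟨⟨by rw [h (mem_Ici.2 le_rfl), hg.1.1], hg.1.2.1.congr h, hg.1.2.2.congr h.symm⟩,
    hg.2.congr' ((eventually_ge_atTop 0).mono fun s hs => (h hs).symm)⟩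

lemma classKInf_const_mul_rpow {a p : ℝ} (ha : 0 < a) (hp : 0 < p) :
    ClassKInf (fun s => a * s ^ p) := by
  refine ⟨⟨by simp [Real.zero_rpow hp.ne'], ?_, ?_⟩, (tendsto_rpow_atTop hp).const_mul_atTop ha⟩
  · exact (continuous_const.mul (Real.continuous_rpow_const hp.le)).continuousOn
  · intro x hx y _ hxy
    have := Real.rpow_lt_rpow hx hxy hp
    exact mul_lt_mul_of_pos_left this ha

lemma classKInfDeriv_sq {g : ℝ → ℝ} {a : ℝ} (ha : 0 < a)
    (hg : ∀ s, 0 ≤ s → g s = a * s ^ 2) : ClassKInfDeriv g := by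
  refine ⟨classKInf_of_eqOn (classKInf_const_mul_rpow ha two_pos) fun s hs => ?_, ?_, ?_⟩
  · simp [hg s hs]
  · have : DifferentiableOn ℝ (fun s : ℝ => a * s ^ 2) (Ici 0) := by fun_prop
    exact this.congr hg
  · refine classKInf_of_eqOn (classKInf_const_mul_rpow (a := 2 * a) (by positivity) one_pos)
      fun s hs => ?_
    simp [derivHalf_sq hg hs]

lemma classK_sum {ι : Type*} {s : Finset ι} (hs : s.Nonempty) {g : ι → ℝ → ℝ}
    (hg : ∀ i ∈ s, ClassK (g i)) : ClassK (fun t => ∑ i ∈ s, g i t) :=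
  ⟨Finset.sum_eq_zero fun i hi => (hg i hi).1,
    continuousOn_finsetSum _ fun i hi => (hg i hi).2.1,
    fun _ ha _ hb hab => Finset.sum_lt_sum_of_nonempty hs fun i hi => (hg i hi).2.2 ha hb hab⟩

/-! ### Existence of solutions for continuous vector fields -/

section Peano

variable {X : Type*} [NormedAddCommGroup X] [NormedSpace ℝ X]

/-- The Euler polygon of step `h` for `ẏ = F(y)`. -/
noncomputable def euler (F : X → X) (x₀ : X) (h : ℝ) : ℕ → X
  | 0 => x₀
  | j + 1 => euler F x₀ h j + h • F (euler F x₀ h j)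

/-- While the field stays within `ε` of `v` at the nodes, each step adds an error of at most `h *
ε`. The case `v = 0` gives the Lipschitz bound on the polygons, and `v = F (y t)` gives
differentiability of their limit. -/
lemma norm_euler_sub_sub_le {F : X → X} {x₀ v : X} {h ε : ℝ} (hh : 0 ≤ h) {a b : ℕ}
    (hab : a ≤ b) (hF : ∀ j, a ≤ j → j < b → ‖F (euler F x₀ h j) - v‖ ≤ ε) :
    ‖euler F x₀ h b - euler F x₀ h a - (h * (b - a)) • v‖ ≤ ε * (h * (b - a)) := by
  induction b, hab using Nat.le_induction with
  | base => simp
  | succ b hab ih =>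
    have h1 := ih fun j hj hjb => hF j hj (by omega)
    have h2 := hF b hab (by omega)
    have h3 : euler F x₀ h (b + 1) - euler F x₀ h a - (h * ((b + 1 : ℕ) - a)) • v
        = (euler F x₀ h b - euler F x₀ h a - (h * (b - a)) • v)
          + h • (F (euler F x₀ h b) - v) := by
      simp only [euler]
      push_cast
      module
    rw [h3]
    refine (norm_add_le _ _).trans ?_
    rw [norm_smul, Real.norm_of_nonneg hh]
    push_cast
    nlinarith

lemma norm_euler_sub_le {F : X → X} {x₀ : X} {h : ℝ} (hh : 0 ≤ h) (hF : ∀ x, ‖F x‖ ≤ 1)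
    (a b : ℕ) : ‖euler F x₀ h b - euler F x₀ h a‖ ≤ |h * b - h * a| := by
  wlog hab : a ≤ b generalizing a b
  · rw [norm_sub_rev, abs_sub_comm]
    exact this b a (by omega)
  have := norm_euler_sub_sub_le (F := F) (x₀ := x₀) (v := 0) (ε := 1) hh hab
    fun j _ _ => by simpa using hF _
  rw [smul_zero, sub_zero, one_mul, mul_sub] at this
  exact this.trans (le_abs_self _)

/-- **Peano's theorem**, global form for bounded continuous vector fields. -/
theorem exists_solution_of_bounded [ProperSpace X] {F : X → X} (hF : Continuous F)
    (hb : ∀ x, ‖F x‖ ≤ 1) (x₀ : X) :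
    ∃ y : ℝ → X, y 0 = x₀ ∧ Continuous y ∧ (∀ t, 0 < t → HasDerivAt y (F (y t)) t) ∧
      ∀ s t, ‖y s - y t‖ ≤ |s - t| := by
  let h : ℕ → ℝ := fun N => 1 / ((N : ℝ) + 1)
  have hpos : ∀ N, 0 < h N := fun N => by positivity
  let idx : ℕ → ℝ → ℕ := fun N t => ⌊t * ((N : ℝ) + 1)⌋₊
  -- A nonprincipal ultrafilter replaces the Arzelà–Ascoli extraction: at each time the polygons lie
  -- in a compact ball, so their limit along `U` exists for all times at once.
  let U : Ultrafilter ℕ := hyperfilter ℕ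
  have hU : (U : Filter ℕ) ≤ atTop := by
    rw [← Nat.cofinite_eq_atTop]; exact hyperfilter_le_cofinite
  have hN : Tendsto (fun N : ℕ => (N : ℝ) + 1) atTop atTop :=
    tendsto_atTop_add_const_right _ _ tendsto_natCast_atTop_atTop
  have hh0 : Tendsto h U (𝓝 0) := (tendsto_one_div_add_atTop_nhds_zero_nat (𝕜 := ℝ)).mono_left hU
  have hidx : ∀ t, 0 ≤ t → Tendsto (fun N => h N * idx N t) U (𝓝 t) := by
    intro t ht
    refine (((tendsto_nat_floor_mul_div_atTop ht).comp hN).mono_left hU).congr fun N => ?_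
    simp only [Function.comp, h, idx]
    ring
  have hidx' : ∀ t, t ≤ 0 → ∀ N, idx N t = 0 := fun t ht N =>
    Nat.floor_of_nonpos (mul_nonpos_of_nonpos_of_nonneg ht (by positivity))
  let z : ℕ → ℝ → X := fun N t => euler F x₀ (h N) (idx N t)
  have hz : ∀ t, ∃ y, Tendsto (fun N => z N t) U (𝓝 y) := by
    intro t
    have hmem : ∀ N, z N t ∈ Metric.closedBall x₀ |t| := by
      intro N
      rw [mem_closedBall_iff_norm]
      refine (norm_euler_sub_le (hpos N).le hb 0 (idx N t)).trans ?_
      rcases le_total t 0 with ht | ht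
      · simp [hidx' t ht N]
      · have h1 : (idx N t : ℝ) ≤ t * ((N : ℝ) + 1) := Nat.floor_le (by positivity)
        have h2 : h N * idx N t ≤ t := by
          simp only [h]
          rw [one_div_mul_eq_div, div_le_iff₀ (by positivity)]
          exact h1
        have h3 : 0 ≤ h N * idx N t := by have := hpos N; positivity
        simpa [abs_of_nonneg h3, abs_of_nonneg ht] using h2
    obtain ⟨y, -, hy⟩ := (isCompact_closedBall x₀ |t|).ultrafilter_le_nhds (U.map fun N => z N t)
      (by
        rw [Filter.le_principal_iff]
        exact Filter.mem_map.2 (Filter.univ_mem' hmem))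
    exact ⟨y, hy⟩
  choose y hy using hz
  have hy0 : ∀ t, t ≤ 0 → y t = x₀ := by
    intro t ht
    refine tendsto_nhds_unique (hy t) (tendsto_const_nhds.congr fun N => ?_)
    simp only [z, hidx' t ht N, euler]
  have hlip0 : ∀ s t, 0 ≤ s → 0 ≤ t → ‖y s - y t‖ ≤ |s - t| := by
    intro s t hs ht
    refine le_of_tendsto_of_tendsto ((hy s).sub (hy t)).norm ((hidx s hs).sub (hidx t ht)).abs
      (Eventually.of_forall fun N => ?_)
    exact norm_euler_sub_le (hpos N).le hb _ _
  have hmax : ∀ s, y s = y (max s 0) := by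
    intro s
    rcases le_total s 0 with hs | hs
    · rw [max_eq_right hs, hy0 s hs, hy0 0 le_rfl]
    · rw [max_eq_left hs]
  have hlip : ∀ s t, ‖y s - y t‖ ≤ |s - t| := by
    intro s t
    rw [hmax s, hmax t]
    exact (hlip0 _ _ (le_max_right _ _) (le_max_right _ _)).trans (abs_max_sub_max_le_abs s t 0)
  have hcont : Continuous y :=
    (LipschitzWith.of_dist_le_mul (K := 1) fun s t => by
      simpa [dist_eq_norm] using hlip s t).continuous
  refine ⟨y, hy0 0 le_rfl, hcont, fun t ht => ?_, hlip⟩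
  have key : ∀ ε, 0 < ε → ∃ δ, 0 < δ ∧ ∀ s s', 0 ≤ s → s ≤ s' → t - δ ≤ s → s' ≤ t + δ →
      ‖y s' - y s - (s' - s) • F (y t)‖ ≤ ε * (s' - s) := by
    intro ε hε
    obtain ⟨δ, hδ, hFδ⟩ := Metric.continuous_iff.1 hF (y t) ε hε
    -- A node between `s` and `s'` differs in time from the node of `t` by less than `δ / 4` plus
    -- one step, hence by at most `δ / 2`. A further `δ / 4` covers the distance from `z N t` to its
    -- limit, so `F` at the nodes is within `ε` of `F (y t)`.
    refine ⟨δ / 4, by positivity, fun s s' hs hss hst hst' => ?_⟩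
    have hlim1 := (hidx s' (hs.trans hss)).sub (hidx s hs)
    refine le_of_tendsto_of_tendsto
      (((hy s').sub (hy s)).sub (hlim1.smul_const (F (y t)))).norm (hlim1.const_mul ε) ?_
    have e1 : ∀ᶠ N in U, ‖z N t - y t‖ < δ / 4 := by
      have := (tendsto_iff_norm_sub_tendsto_zero.1 (hy t)).eventually_lt_const
        (show (0 : ℝ) < δ / 4 by positivity)
      exact this
    have e2 : ∀ᶠ N in U, h N < δ / 4 := hh0.eventually_lt_const (by positivity)
    filter_upwards [e1, e2] with N h1 h2
    have hfl : ∀ τ, 0 ≤ τ → h N * idx N τ ≤ τ ∧ τ < h N * idx N τ + h N := by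
      intro τ hτ
      have a1 : (idx N τ : ℝ) ≤ τ * ((N : ℝ) + 1) := Nat.floor_le (by positivity)
      have a2 : τ * ((N : ℝ) + 1) < idx N τ + 1 := Nat.lt_floor_add_one _
      have a3 : h N * ((N : ℝ) + 1) = 1 := by simp only [h]; field_simp
      have a4 := hpos N
      constructor
      · calc h N * idx N τ ≤ h N * (τ * ((N : ℝ) + 1)) := by gcongr
          _ = τ * (h N * ((N : ℝ) + 1)) := by ring
          _ = τ := by rw [a3, mul_one]
      · calc τ = τ * (h N * ((N : ℝ) + 1)) := by rw [a3, mul_one]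
          _ = h N * (τ * ((N : ℝ) + 1)) := by ring
          _ < h N * (idx N τ + 1) := by gcongr
          _ = _ := by ring
    have hle : idx N s ≤ idx N s' := Nat.floor_mono (by gcongr)
    have := norm_euler_sub_sub_le (F := F) (x₀ := x₀) (v := F (y t)) (ε := ε) (hpos N).le hle ?_
    · simpa only [mul_sub] using this
    intro j hj hj'
    have hj1 : h N * idx N s ≤ h N * j := by have := hpos N; gcongr
    have hj2 : h N * j ≤ h N * idx N s' := by have := hpos N; gcongr
    have b1 := hfl s hs
    have b2 := hfl s' (hs.trans hss)
    have b3 := hfl t ht.le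
    have hd : ‖euler F x₀ (h N) j - z N t‖ ≤ δ / 2 :=
      (norm_euler_sub_le (hpos N).le hb (idx N t) j).trans
        (abs_le.2 ⟨by linarith, by linarith⟩)
    rw [← dist_eq_norm]
    refine (hFδ _ ?_).le
    rw [dist_eq_norm]
    calc ‖euler F x₀ (h N) j - y t‖ ≤ ‖euler F x₀ (h N) j - z N t‖ + ‖z N t - y t‖ :=
          norm_sub_le_norm_sub_add_norm_sub _ _ _
      _ < δ := by linarith
  rw [hasDerivAt_iff_isLittleO, Asymptotics.isLittleO_iff]
  intro ε hε
  obtain ⟨δ, hδ, hk⟩ := key ε hε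
  filter_upwards [Metric.ball_mem_nhds t hδ, Ioi_mem_nhds ht] with s hs hs0
  rw [Metric.mem_ball, Real.dist_eq, abs_lt] at hs
  rw [mem_Ioi] at hs0
  rcases le_total s t with hst | hst
  · have := hk s t hs0.le hst (by linarith) (by linarith)
    rw [Real.norm_eq_abs, abs_of_nonpos (by linarith), neg_sub, ← norm_neg]
    convert! this using 2
    module
  · rw [Real.norm_eq_abs, abs_of_nonneg (by linarith)]
    exact hk t s ht.le hst (by linarith) (by linarith)

/-- A continuous vector field has a solution through every point that is global or escapes to
infinity in finite time. -/
theorem exists_maximal_solution [ProperSpace X] {F : X → X} (hF : Continuous F) (x₀ : X) :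
    ∃ (T : EReal) (x : ℝ → X), 0 < T ∧ ContinuousOn x {t : ℝ | 0 ≤ t ∧ (t : EReal) < T} ∧
      (∀ t : ℝ, 0 ≤ t → (t : EReal) < T → x t = x₀ + ∫ s in (0 : ℝ)..t, F (x s)) ∧
      (T = ⊤ ∨ Tendsto (fun t => ‖x t‖) (toEnd T) atTop) := by
  -- Slowing the field by `p` bounds its norm by `1`, so a global solution `y` exists. The original
  -- time is `θ`, the integral of `p` along `y`, and the solution is `y` composed with the inverse
  -- of `θ`; its lifetime is the supremum of `θ`.
  let p : X → ℝ := fun x => (1 + ‖F x‖)⁻¹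
  have hp : ∀ x, 0 < p x := fun x => by positivity
  have hpc : Continuous p := (continuous_const.add hF.norm).inv₀ fun x =>
    (show 0 < 1 + ‖F x‖ by positivity).ne'
  obtain ⟨y, hy0, hyc, hyd, hyl⟩ := exists_solution_of_bounded (F := fun x => p x • F x)
    (hpc.smul hF) (fun x => by
      rw [norm_smul, Real.norm_of_nonneg (hp x).le, inv_mul_le_iff₀ (by positivity)]
      linarith) x₀
  have hpy : Continuous fun τ => p (y τ) := hpc.comp hyc
  let θ : ℝ → ℝ := fun τ => ∫ s in (0 : ℝ)..τ, p (y s)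
  have hθs : ∀ τ, HasStrictDerivAt θ (p (y τ)) τ := fun τ =>
    hpy.integral_hasStrictDerivAt 0 τ
  have hθd : ∀ τ, HasDerivAt θ (p (y τ)) τ := fun τ => (hθs τ).hasDerivAt
  have hθm : StrictMono θ := strictMono_of_hasDerivAt_pos hθd fun τ => hp _
  have hθc : Continuous θ := continuous_iff_continuousAt.2 fun τ => (hθd τ).continuousAt
  have hθ0 : θ 0 = 0 := by simp [θ]
  have hθe : IsOpenEmbedding θ := .of_continuous_injective_isOpenMap hθc hθm.injective
    (isOpenMap_of_hasStrictDerivAt hθs fun τ => (hp _).ne')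
  let e := hθe.toOpenPartialHomeomorph θ
  let T : EReal := ⨆ τ : ℝ, (θ τ : EReal)
  have hsymm : ∀ τ, e.symm (θ τ) = τ := fun τ => hθe.toOpenPartialHomeomorph_left_inv θ
  have hlt : ∀ τ, (θ τ : EReal) < T := fun τ =>
    (EReal.coe_lt_coe_iff.2 (hθm (lt_add_one τ))).trans_le
      (le_iSup (fun τ : ℝ => (θ τ : EReal)) (τ + 1))
  have hrange : ∀ t : ℝ, 0 ≤ t → (t : EReal) < T → ∃ τ, 0 ≤ τ ∧ θ τ = t := by
    intro t ht htT
    obtain ⟨τ, hτ⟩ := lt_iSup_iff.1 htT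
    have hτ' : t < θ τ := EReal.coe_lt_coe_iff.1 hτ
    have hτ0 : 0 ≤ τ := by
      by_contra! h
      have := hθm h
      rw [hθ0] at this
      linarith
    obtain ⟨σ, hσ, rfl⟩ := intermediate_value_Icc hτ0 hθc.continuousOn
      (show t ∈ Icc (θ 0) (θ τ) from ⟨by rwa [hθ0], hτ'.le⟩)
    exact ⟨σ, hσ.1, rfl⟩
  let x : ℝ → X := fun t => y (e.symm t)
  have hxθ : ∀ τ, x (θ τ) = y τ := fun τ => by simp only [x, hsymm]
  have hmem : ∀ τ, θ τ ∈ e.target := fun τ => by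
    simp [e]
  have hsd : ∀ τ, HasDerivAt e.symm (p (y τ))⁻¹ (θ τ) := by
    intro τ
    refine e.hasDerivAt_symm (hmem τ) (hp _).ne' ?_
    rw [hsymm]
    exact hθd τ
  have hxc : ∀ τ, ContinuousAt x (θ τ) := fun τ =>
    hyc.continuousAt.comp (hsd τ).continuousAt
  have hxcon : ContinuousOn x {t : ℝ | 0 ≤ t ∧ (t : EReal) < T} := by
    rintro t ⟨ht, htT⟩
    obtain ⟨τ, -, rfl⟩ := hrange t ht htT
    exact (hxc τ).continuousWithinAt
  refine ⟨T, x, ?_, hxcon, ?_, ?_⟩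
  · have := hlt 0
    rwa [hθ0] at this
  · intro t ht htT
    have hsub : Icc 0 t ⊆ {t : ℝ | 0 ≤ t ∧ (t : EReal) < T} := fun s hs =>
      ⟨hs.1, (EReal.coe_le_coe_iff.2 hs.2).trans_lt htT⟩
    have hxI := hxcon.mono hsub
    rw [intervalIntegral.integral_eq_sub_of_hasDeriv_right (f := x) (by rwa [uIcc_of_le ht])]
    · have : x 0 = x₀ := by rw [← hθ0, hxθ, hy0]
      rw [this]; abel
    · intro s hs
      rw [min_eq_left ht, max_eq_right ht] at hs
      obtain ⟨τ, hτ0, rfl⟩ := hrange s hs.1.le (hsub ⟨hs.1.le, hs.2.le⟩).2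
      have hτ : 0 < τ := by
        rcases hτ0.eq_or_lt with h | h
        · rw [← h, hθ0] at hs
          exact absurd hs.1 (lt_irrefl _)
        · exact h
      have h1 : HasDerivAt x ((p (y τ))⁻¹ • (p (y τ) • F (y τ))) (θ τ) :=
        HasDerivAt.scomp_of_eq (θ τ) (hyd τ hτ) (hsd τ) (hsymm τ).symm
      rw [inv_smul_smul₀ (hp _).ne', ← hxθ] at h1
      exact h1.hasDerivWithinAt
    · refine ContinuousOn.intervalIntegrable ?_
      rw [uIcc_of_le ht]
      exact hF.comp_continuousOn hxI
  · by_cases hT : T = ⊤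
    · exact Or.inl hT
    right
    have hT0 : T ≠ ⊥ := fun h => by
      have := hlt 0
      simp [h] at this
    obtain ⟨T', hT'⟩ : ∃ T' : ℝ, T = T' := ⟨T.toReal, (EReal.coe_toReal hT hT0).symm⟩
    have hlt' : ∀ τ, θ τ < T' := fun τ => by
      have := hlt τ
      rw [hT'] at this
      exact EReal.coe_lt_coe_iff.1 this
    have hsup : ∀ b < T', ∃ τ, b < θ τ := by
      intro b hb
      have : (b : EReal) < T := by rw [hT']; exact EReal.coe_lt_coe_iff.2 hb
      obtain ⟨τ, hτ⟩ := lt_iSup_iff.1 this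
      exact ⟨τ, EReal.coe_lt_coe_iff.1 hτ⟩
    -- If `‖y τ‖ < M` at a late `τ`, then `y` stays in the ball of radius `M + 1` during the next
    -- unit of slowed time, as it is `1`-Lipschitz. There `p` is bounded below, so `θ` gains a fixed
    -- amount and overshoots its supremum `T'`.
    have hyt : Tendsto (fun τ => ‖y τ‖) atTop atTop := by
      rw [tendsto_atTop]
      intro M
      obtain ⟨C, hC⟩ := (isCompact_closedBall (0 : X) (M + 1)).exists_bound_of_continuousOn
        hF.continuousOn
      obtain ⟨τ₀, hτ₀⟩ := hsup (T' - (1 + max C 0)⁻¹) (by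
        have : 0 < (1 + max C 0)⁻¹ := by positivity
        linarith)
      filter_upwards [eventually_ge_atTop τ₀] with τ hτ
      by_contra! hM
      have hge : ∀ s ∈ Icc τ (τ + 1), (1 + max C 0)⁻¹ ≤ p (y s) := by
        intro s hs
        have h1 := hyl s τ
        rw [abs_of_nonneg (by linarith [hs.1])] at h1
        have h2 : ‖y s‖ ≤ ‖y s - y τ‖ + ‖y τ‖ := norm_le_norm_sub_add _ _
        have h3 := hC (y s) (by
          rw [mem_closedBall_zero_iff]
          linarith [hs.2])
        have h4 := le_max_left C 0
        exact inv_anti₀ (by positivity) (by linarith)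
      have hint : (1 + max C 0)⁻¹ ≤ θ (τ + 1) - θ τ := by
        have h1 : θ (τ + 1) - θ τ = ∫ s in τ..(τ + 1), p (y s) :=
          intervalIntegral.integral_interval_sub_left (hpy.intervalIntegrable _ _)
            (hpy.intervalIntegrable _ _)
        have h2 := intervalIntegral.integral_mono_on (μ := volume) (show τ ≤ τ + 1 by linarith)
          (intervalIntegrable_const (c := (1 + max C 0)⁻¹)) (hpy.intervalIntegrable _ _) hge
        rw [h1]
        simpa using h2
      have := hlt' (τ + 1)
      have := hθm.monotone hτ
      linarith
    have hst : Tendsto e.symm (toEnd T) atTop := by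
      rw [toEnd, if_neg hT, hT', EReal.toReal_coe, tendsto_atTop]
      intro τ
      have : ∀ᶠ t in 𝓝[<] T', t ∈ Ioo (max (θ τ) 0) T' :=
        Ioo_mem_nhdsLT (max_lt (hlt' τ) (by rw [← hθ0]; exact hlt' 0))
      filter_upwards [this] with t ht
      obtain ⟨σ, -, rfl⟩ := hrange t ((le_max_right _ _).trans ht.1.le) (by
        rw [hT']; exact EReal.coe_lt_coe_iff.2 ht.2)
      rw [hsymm]
      exact (hθm.lt_iff_lt.1 ((le_max_left _ _).trans_lt ht.1)).le
    exact hyt.comp hst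

end Peano

/-! ### The chain rule along absolutely continuous curves -/

section ChainRule

variable {X : Type*} [NormedAddCommGroup X] [NormedSpace ℝ X]

lemma absolutelyContinuousOnInterval_of_dist_le {Y Z : Type*} [PseudoMetricSpace Y]
    [PseudoMetricSpace Z] {f : ℝ → Y} {g : ℝ → Z} {a b K : ℝ} (hK : 0 ≤ K)
    (hg : AbsolutelyContinuousOnInterval g a b)
    (h : ∀ s ∈ uIcc a b, ∀ t ∈ uIcc a b, dist (f s) (f t) ≤ K * dist (g s) (g t)) :
    AbsolutelyContinuousOnInterval f a b := by
  rw [absolutelyContinuousOnInterval_iff] at hg ⊢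
  intro ε hε
  obtain ⟨δ, hδ, hgδ⟩ := hg (ε / (K + 1)) (by positivity)
  refine ⟨δ, hδ, fun I hI hlen => ?_⟩
  have h1 := hgδ I hI hlen
  rw [lt_div_iff₀ (by positivity)] at h1
  have h2 : ∑ i ∈ Finset.range I.1, dist (f (I.2 i).1) (f (I.2 i).2)
      ≤ K * ∑ i ∈ Finset.range I.1, dist (g (I.2 i).1) (g (I.2 i).2) := by
    rw [Finset.mul_sum]
    exact Finset.sum_le_sum fun i hi => h _ (hI.1 i hi).1 _ (hI.1 i hi).2
  have h3 : 0 ≤ ∑ i ∈ Finset.range I.1, dist (g (I.2 i).1) (g (I.2 i).2) :=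
    Finset.sum_nonneg fun _ _ => dist_nonneg
  nlinarith

/-- The chain rule for a `C¹` function along an absolutely continuous curve. -/
lemma comp_sub_eq_integral_fderiv [ProperSpace X] {φ : X → ℝ} (hφ : ContDiff ℝ 1 φ)
    {x g : ℝ → X} {b : ℝ} (hb : 0 ≤ b) (hg : IntervalIntegrable g volume 0 b)
    (hx : ∀ t ∈ Icc 0 b, x t = x 0 + ∫ s in (0 : ℝ)..t, g s) :
    φ (x b) - φ (x 0) = ∫ s in (0 : ℝ)..b, fderiv ℝ φ (x s) (g s) := by
  have hu : uIcc 0 b = Icc 0 b := uIcc_of_le hb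
  -- The equation for `x` is known on `[0, b]` only; the primitive `y` is defined for all times, so
  -- two-sided derivatives make sense at the endpoint too.
  let y : ℝ → X := fun t => x 0 + ∫ s in (0 : ℝ)..t, g s
  have hsub : ∀ t ∈ Icc 0 b, IntervalIntegrable g volume 0 t := fun t ht =>
    hg.mono_set (by rw [uIcc_of_le ht.1, hu]; exact Icc_subset_Icc_right ht.2)
  -- `G` dominates the increments of `y`, and `φ` is Lipschitz on a ball containing the curve. Hence
  -- `φ ∘ y` inherits absolute continuity from `G`, and the fundamental theorem of calculus applies.
  let G : ℝ → ℝ := fun t => ∫ s in (0 : ℝ)..t, ‖g s‖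
  have hG : AbsolutelyContinuousOnInterval G 0 b :=
    hg.norm.absolutelyContinuousOnInterval_intervalIntegral left_mem_uIcc
  have hyG : ∀ s ∈ Icc 0 b, ∀ t ∈ Icc 0 b, dist (y s) (y t) ≤ dist (G s) (G t) := by
    intro s hs t ht
    have e1 : y s - y t = ∫ τ in t..s, g τ := by
      simp only [y, add_sub_add_left_eq_sub]
      exact intervalIntegral.integral_interval_sub_left (hsub s hs) (hsub t ht)
    have e2 : G s - G t = ∫ τ in t..s, ‖g τ‖ :=
      intervalIntegral.integral_interval_sub_left (hsub s hs).norm (hsub t ht).norm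
    rw [dist_eq_norm, e1, Real.dist_eq, e2]
    exact intervalIntegral.norm_integral_le_abs_integral_norm
  have hyc : ContinuousOn y (Icc 0 b) :=
    continuousOn_const.add (by
      have := intervalIntegral.continuousOn_primitive_interval' hg left_mem_uIcc
      rwa [hu] at this)
  obtain ⟨C, hC⟩ := isCompact_Icc.exists_bound_of_continuousOn hyc
  obtain ⟨K, hK⟩ := hφ.contDiffOn.exists_lipschitzOnWith (by decide)
    (convex_closedBall (0 : X) C) (isCompact_closedBall (0 : X) C)
  have hAC : AbsolutelyContinuousOnInterval (fun t => φ (y t)) 0 b := by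
    refine absolutelyContinuousOnInterval_of_dist_le K.2 hG fun s hs t ht => ?_
    rw [hu] at hs ht
    refine (hK.dist_le_mul _ (mem_closedBall_zero_iff.2 (hC s hs)) _
      (mem_closedBall_zero_iff.2 (hC t ht))).trans ?_
    exact mul_le_mul_of_nonneg_left (hyG s hs t ht) K.2
  have hxy : ∀ t ∈ Icc 0 b, x t = y t := hx
  rw [hxy b (right_mem_Icc.2 hb), show x 0 = y 0 from hxy 0 (left_mem_Icc.2 hb),
    ← hAC.integral_deriv_eq_sub]
  refine intervalIntegral.integral_congr_ae ?_
  filter_upwards [hg.ae_hasDerivAt_integral] with t ht htI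
  rw [uIoc_of_le hb] at htI
  have htI' : t ∈ Icc 0 b := Ioc_subset_Icc_self htI
  have h1 : HasDerivAt y (g t) t :=
    (ht (by rwa [hu]) 0 left_mem_uIcc).const_add (x 0)
  rw [hxy t htI']
  exact (((hφ.differentiable (by norm_num)).differentiableAt.hasFDerivAt
    (x := y t)).comp_hasDerivAt t h1).deriv

end ChainRule

/-- A continuous cutoff, `0` for `v ≤ ε` and `1` for `v ≥ 2ε`. -/
noncomputable def cutoff (ε v : ℝ) : ℝ := min 1 (max 0 (v / ε - 1))

lemma continuous_cutoff (ε : ℝ) : Continuous (cutoff ε) := by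
  unfold cutoff; fun_prop

lemma abs_cutoff_le (ε v : ℝ) : |cutoff ε v| ≤ 1 := by
  rw [abs_of_nonneg (le_min zero_le_one (le_max_left _ _))]
  exact min_le_left _ _

lemma cutoff_eq_zero {ε v : ℝ} (hε : 0 < ε) (hv : v ≤ ε) : cutoff ε v = 0 := by
  have : v / ε - 1 ≤ 0 := by rw [sub_nonpos, div_le_one hε]; exact hv
  rw [cutoff, max_eq_left this]
  simp

lemma cutoff_eq_one {ε v : ℝ} (hε : 0 < ε) (hv : 2 * ε ≤ v) : cutoff ε v = 1 := by
  have : 1 ≤ v / ε - 1 := by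
    have : 2 ≤ v / ε := (le_div_iff₀ hε).2 hv
    linarith
  rw [cutoff, min_eq_left (this.trans (le_max_right _ _))]

lemma tendsto_cutoff {v : ℝ} (hv : 0 < v) :
    Tendsto (fun N : ℕ => cutoff (1 / ((N : ℝ) + 1)) v) atTop (𝓝 1) := by
  refine tendsto_const_nhds.congr' ?_
  have := (tendsto_one_div_add_atTop_nhds_zero_nat (𝕜 := ℝ)).eventually_lt_const
    (show (0 : ℝ) < v / 2 by positivity)
  filter_upwards [this] with N hN
  rw [cutoff_eq_one (by positivity) (by linarith)]

/-- The primitive of the cutoff. -/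
noncomputable def cutoffPrimitive (ε v : ℝ) : ℝ := ∫ s in (0 : ℝ)..v, cutoff ε s

lemma hasDerivAt_cutoffPrimitive (ε v : ℝ) :
    HasDerivAt (cutoffPrimitive ε) (cutoff ε v) v :=
  ((continuous_cutoff ε).integral_hasStrictDerivAt 0 v).hasDerivAt

lemma contDiff_cutoffPrimitive (ε : ℝ) : ContDiff ℝ 1 (cutoffPrimitive ε) := by
  rw [contDiff_one_iff_deriv]
  refine ⟨fun v => (hasDerivAt_cutoffPrimitive ε v).differentiableAt, ?_⟩
  rw [funext fun v => (hasDerivAt_cutoffPrimitive ε v).deriv]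
  exact continuous_cutoff ε

lemma cutoffPrimitive_eq_zero {ε v : ℝ} (hε : 0 < ε) (hv : v ≤ ε) : cutoffPrimitive ε v = 0 := by
  have h : EqOn (cutoff ε) (fun _ => 0) (uIcc 0 v) := fun s hs =>
    cutoff_eq_zero hε (hs.2.trans (max_le hε.le hv))
  rw [cutoffPrimitive, intervalIntegral.integral_congr h, intervalIntegral.integral_zero]

lemma tendsto_cutoffPrimitive {v : ℝ} (hv : 0 ≤ v) :
    Tendsto (fun N : ℕ => cutoffPrimitive (1 / ((N : ℝ) + 1)) v) atTop (𝓝 v) := by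
  have h : Tendsto (fun N : ℕ => ∫ s in (0 : ℝ)..v, cutoff (1 / ((N : ℝ) + 1)) s) atTop
      (𝓝 (∫ _s in (0 : ℝ)..v, (1 : ℝ))) := by
    refine intervalIntegral.tendsto_integral_filter_of_dominated_convergence (fun _ => 1)
      (Eventually.of_forall fun N => (continuous_cutoff _).aestronglyMeasurable)
      (Eventually.of_forall fun N => Eventually.of_forall fun s _ => abs_cutoff_le _ _)
      intervalIntegrable_const (Eventually.of_forall fun s hs => ?_)
    rw [uIoc_of_le hv] at hs
    exact tendsto_cutoff hs.1
  rw [intervalIntegral.integral_const, sub_zero, smul_eq_mul, mul_one] at h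
  exact h

/-! ### Chain rule for functions that may fail to be differentiable at the origin -/

section Lyapunov

variable {n : ℕ} {V : E n → ℝ}

/-- The composite vanishes near the origin, where `V < ε`, so the possible singularity of `V` there
disappears; elsewhere this is the ordinary chain rule. -/
lemma hasFDerivAt_cutoffPrimitive_comp (hV : ContDiffOn ℝ 1 V {0}ᶜ) (hpos : IsPosDef V)
    (hc : Continuous V) {ε : ℝ} (hε : 0 < ε) (x : E n) :
    ContDiffAt ℝ 1 (fun y => cutoffPrimitive ε (V y)) x ∧
      HasFDerivAt (fun y => cutoffPrimitive ε (V y)) (cutoff ε (V x) • fderiv ℝ V x) x := by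
  rcases eq_or_ne x 0 with rfl | hx
  · have h0 : (fun y => cutoffPrimitive ε (V y)) =ᶠ[𝓝 0] fun _ => (0 : ℝ) := by
      have : ∀ᶠ y in 𝓝 (0 : E n), V y < ε :=
        hc.continuousAt.eventually_lt_const (by rwa [hpos.1])
      filter_upwards [this] with y hy
      exact cutoffPrimitive_eq_zero hε hy.le
    refine ⟨contDiffAt_const.congr_of_eventuallyEq h0, ?_⟩
    rw [hpos.fderiv_zero, smul_zero]
    exact (hasFDerivAt_const (0 : ℝ) (0 : E n)).congr_of_eventuallyEq h0
  · refine ⟨?_, ?_⟩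
    · exact (contDiff_cutoffPrimitive ε).contDiffAt.comp x
        (hV.contDiffAt (isOpen_compl_singleton.mem_nhds hx))
    · exact (hasDerivAt_cutoffPrimitive ε (V x)).comp_hasFDerivAt x
        (differentiableAt_of_contDiffOn hV hx).hasFDerivAt

/-- The chain rule for a positive definite function that is `C¹` away from the origin. -/
lemma sub_eq_integral_fderiv (hV : ContDiffOn ℝ 1 V {0}ᶜ) (hpos : IsPosDef V)
    (hc : Continuous V) {x g : ℝ → E n} {b : ℝ} (hb : 0 ≤ b)
    (hg : IntervalIntegrable g volume 0 b)
    (hx : ∀ t ∈ Icc 0 b, x t = x 0 + ∫ s in (0 : ℝ)..t, g s)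
    (hxc : ContinuousOn x (Icc 0 b))
    (hD : IntervalIntegrable (fun s => fderiv ℝ V (x s) (g s)) volume 0 b) :
    V (x b) - V (x 0) = ∫ s in (0 : ℝ)..b, fderiv ℝ V (x s) (g s) := by
  have hεpos : ∀ N : ℕ, (0 : ℝ) < 1 / ((N : ℝ) + 1) := fun N => by positivity
  have key : ∀ N : ℕ, cutoffPrimitive (1 / ((N : ℝ) + 1)) (V (x b))
      - cutoffPrimitive (1 / ((N : ℝ) + 1)) (V (x 0))
      = ∫ s in (0 : ℝ)..b, cutoff (1 / ((N : ℝ) + 1)) (V (x s)) * fderiv ℝ V (x s) (g s) := by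
    intro N
    have hcd : ContDiff ℝ 1 fun y => cutoffPrimitive (1 / ((N : ℝ) + 1)) (V y) :=
      contDiff_iff_contDiffAt.2 fun y =>
        (hasFDerivAt_cutoffPrimitive_comp hV hpos hc (hεpos N) y).1
    rw [comp_sub_eq_integral_fderiv hcd hb hg hx]
    refine intervalIntegral.integral_congr fun s _ => ?_
    simp only [(hasFDerivAt_cutoffPrimitive_comp hV hpos hc (hεpos N) (x s)).2.fderiv]
    simp
  have hl := (tendsto_cutoffPrimitive (hpos.nonneg (x b))).sub
    (tendsto_cutoffPrimitive (hpos.nonneg (x 0)))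
  refine tendsto_nhds_unique (hl.congr key) ?_
  -- The cutoffs tend to `1` wherever `x s ≠ 0`; where `x s = 0` the integrand is zero because
  -- `fderiv ℝ V 0 = 0`, so time spent at the origin contributes nothing.
  refine intervalIntegral.tendsto_integral_filter_of_dominated_convergence
    (fun s => ‖fderiv ℝ V (x s) (g s)‖)
    (Eventually.of_forall fun N => ?_)
    (Eventually.of_forall fun N => Eventually.of_forall fun s _ => ?_)
    hD.norm (Eventually.of_forall fun s hs => ?_)
  · refine AEStronglyMeasurable.mul ?_ hD.aestronglyMeasurable_restrict_uIoc
    rw [uIoc_of_le hb]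
    exact ((((continuous_cutoff _).comp hc).comp_continuousOn hxc).mono
      Ioc_subset_Icc_self).aestronglyMeasurable measurableSet_Ioc
  · rw [norm_mul, Real.norm_eq_abs]
    exact mul_le_of_le_one_left (norm_nonneg _) (abs_cutoff_le _ _)
  · by_cases h0 : x s = 0
    · simp [h0, hpos.fderiv_zero]
    · simpa using (tendsto_cutoff (hpos.2 _ h0)).mul_const (fderiv ℝ V (x s) (g s))

end Lyapunov

/-! ### Lie derivatives of the value function along the system -/

section System

variable {n ξ l : ℕ} {S : ControlSystem n ξ l} {r : Fin n → ℝ} {r₀ k ϑ : ℝ}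
  {V R : E n → ℝ}

lemma IsHomogeneousSystem.r₀_pos (hS : IsHomogeneousSystem S r r₀ k ϑ) : 0 < r₀ := by
  obtain ⟨i, hi⟩ := hS.r₀_least.1
  rw [← hi]; exact hS.r_pos i

lemma IsHomogeneousSystem.univ_nonempty (hS : IsHomogeneousSystem S r r₀ k ϑ) :
    (Finset.univ : Finset (Fin n)).Nonempty := by
  obtain ⟨i, -⟩ := hS.r₀_least.1
  exact ⟨i, Finset.mem_univ i⟩

lemma IsHomogeneousSystem.degree_pos (hS : IsHomogeneousSystem S r r₀ k ϑ) : 0 < k + r₀ := by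
  have := hS.k_gt; linarith

/-- A value function for a homogeneous system: positive definite, `C¹` away from the origin and
homogeneous of degree `k + 2 r₀`. -/
structure IsValueFunction (r : Fin n → ℝ) (r₀ k : ℝ) (V : E n → ℝ) : Prop where
  diff : ContDiffOn ℝ 1 V {0}ᶜ
  pos : IsPosDef V
  hom : IsHomogeneousFn r (k + 2 * r₀) V

lemma IsValueFunction.continuous (hV : IsValueFunction r r₀ k V)
    (hS : IsHomogeneousSystem S r r₀ k ϑ) : Continuous V :=
  hV.hom.continuous hS.r_pos (by have := hS.degree_pos; have := hS.r₀_pos; linarith)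
    hV.diff.continuousOn hV.pos.1

lemma IsValueFunction.hom_f (hV : IsValueFunction r r₀ k V)
    (hS : IsHomogeneousSystem S r r₀ k ϑ) :
    IsHomogeneousFn r (2 * k + 2 * r₀) (lieDeriv V S.f) :=
  (isHomogeneousFn_lieDeriv hV.pos hV.diff hV.hom hS.f_hom).congr_degree (by ring)

lemma IsValueFunction.hom_G₁ (hV : IsValueFunction r r₀ k V)
    (hS : IsHomogeneousSystem S r r₀ k ϑ) :
    IsHomogeneousFn r (k + r₀) (lieDeriv V S.G₁) :=
  (isHomogeneousFn_lieDeriv hV.pos hV.diff hV.hom hS.G₁_hom).congr_degree (by ring)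

lemma IsValueFunction.hom_G₂ (hV : IsValueFunction r r₀ k V)
    (hS : IsHomogeneousSystem S r r₀ k ϑ) (j : Fin ξ) :
    IsHomogeneousFn r (k + r₀) (lieDeriv V (S.G₂ j)) :=
  (isHomogeneousFn_lieDeriv hV.pos hV.diff hV.hom (hS.G₂_hom j)).congr_degree (by ring)

lemma IsValueFunction.continuous_f (hV : IsValueFunction r r₀ k V)
    (hS : IsHomogeneousSystem S r r₀ k ϑ) : Continuous (lieDeriv V S.f) :=
  (hV.hom_f hS).continuous hS.r_pos (by have := hS.degree_pos; linarith)
    (continuousOn_lieDeriv hV.diff hS.f_cont) (lieDeriv_zero hV.pos _)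

lemma IsValueFunction.continuous_G₁ (hV : IsValueFunction r r₀ k V)
    (hS : IsHomogeneousSystem S r r₀ k ϑ) : Continuous (lieDeriv V S.G₁) :=
  (hV.hom_G₁ hS).continuous hS.r_pos hS.degree_pos
    (continuousOn_lieDeriv hV.diff hS.G₁_cont) (lieDeriv_zero hV.pos _)

lemma IsValueFunction.continuous_G₂ (hV : IsValueFunction r r₀ k V)
    (hS : IsHomogeneousSystem S r r₀ k ϑ) (j : Fin ξ) : Continuous (lieDeriv V (S.G₂ j)) :=
  (hV.hom_G₂ hS j).continuous hS.r_pos hS.degree_pos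
    (continuousOn_lieDeriv hV.diff (hS.G₂_cont j)) (lieDeriv_zero hV.pos _)

lemma IsValueFunction.continuous_lieG₂ (hV : IsValueFunction r r₀ k V)
    (hS : IsHomogeneousSystem S r r₀ k ϑ) : Continuous (lieG₂ S V) :=
  (PiLp.continuous_toLp 2 _).comp (continuous_pi fun j => hV.continuous_G₂ hS j)

lemma lieG₂_zero (hV : IsPosDef V) : lieG₂ S V 0 = 0 := by
  ext j
  simp [lieG₂, lieDeriv_zero hV]

lemma lieG₂_apply (x : E n) (j : Fin ξ) : lieG₂ S V x j = lieDeriv V (S.G₂ j) x := rfl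

lemma norm_lieG₂_sq (x : E n) : ‖lieG₂ S V x‖ ^ 2 = ∑ j, lieDeriv V (S.G₂ j) x ^ 2 :=
  EuclideanSpace.real_norm_sq_eq _

lemma IsValueFunction.hom_norm_lieG₂_sq (hV : IsValueFunction r r₀ k V)
    (hS : IsHomogeneousSystem S r r₀ k ϑ) :
    IsHomogeneousFn r (2 * k + 2 * r₀) (fun x => ‖lieG₂ S V x‖ ^ 2) := by
  simp only [norm_lieG₂_sq]
  simp only [sq]
  exact IsHomogeneousFn.sum fun j =>
    ((hV.hom_G₂ hS j).mul (hV.hom_G₂ hS j)).congr_degree (by ring)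

lemma IsHomogeneousSystem.hom_norm_h_sq (hS : IsHomogeneousSystem S r r₀ k ϑ) :
    IsHomogeneousFn r (2 * k + 2 * r₀) (fun x => ‖S.h x‖ ^ 2) := by
  simp only [EuclideanSpace.real_norm_sq_eq]
  simp only [sq]
  exact IsHomogeneousFn.sum fun j =>
    ((hS.h_hom j).mul (hS.h_hom j)).congr_degree (by ring)

lemma IsHomogeneousSystem.norm_output_sq (hS : IsHomogeneousSystem S r r₀ k ϑ) (x : E n)
    (u : ℝ) : ‖S.output x u‖ ^ 2 = ‖S.h x‖ ^ 2 + ϑ ^ 2 * u ^ 2 := by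
  rw [ControlSystem.output, norm_add_sq_real, inner_smul_right, hS.h_orth, norm_smul, mul_pow,
    ← real_inner_self_eq_norm_sq S.d, hS.d_norm, Real.norm_eq_abs, sq_abs]
  ring

/-- The derivative of `V` along the system. -/
noncomputable def rate (S : ControlSystem n ξ l) (V : E n → ℝ) (x : E n) (u : ℝ) (w : E ξ) : ℝ :=
  lieDeriv V S.f x + u * lieDeriv V S.G₁ x + ∑ j, w j * lieDeriv V (S.G₂ j) x

lemma fderiv_rhs (x : E n) (u : ℝ) (w : E ξ) : fderiv ℝ V x (S.rhs x u w) = rate S V x u w := by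
  simp [ControlSystem.rhs, rate, lieDeriv, map_sum]

lemma rate_eq_inner (x : E n) (u : ℝ) (w : E ξ) :
    rate S V x u w
      = lieDeriv V S.f x + u * lieDeriv V S.G₁ x + inner ℝ w (lieG₂ S V x) := by
  simp [rate, PiLp.inner_apply, lieG₂_apply, mul_comm]

/-! ### Integrability along solutions -/

section Solution

variable {T : EReal} {x₀ : E n} {u : ℝ → ℝ} {w : ℝ → E ξ} {x : ℝ → E n} {t : ℝ}

lemma IsSolution.apply_zero (h : IsSolution S T x₀ u w x) : x 0 = x₀ := by
  simpa using h.eqn 0 le_rfl (by simpa using h.T_pos)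

lemma IsSolution.lt_of_le (ht : (t : EReal) < T) {s : ℝ} (hs : s ≤ t) : (s : EReal) < T :=
  (EReal.coe_le_coe_iff.2 hs).trans_lt ht

lemma IsSolution.continuousOn_Icc (h : IsSolution S T x₀ u w x) (htT : (t : EReal) < T) :
    ContinuousOn x (Icc 0 t) :=
  h.cont.mono fun _ hs => ⟨hs.1, IsSolution.lt_of_le htT hs.2⟩

lemma IsSolution.continuousOn_uIcc (h : IsSolution S T x₀ u w x) (ht : 0 ≤ t)
    (htT : (t : EReal) < T) : ContinuousOn x (uIcc 0 t) := by
  rw [uIcc_of_le ht]; exact h.continuousOn_Icc htT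

lemma memLp_comp_of_continuousOn (hx : ContinuousOn x (Icc 0 t))
    {Y : Type*} [NormedAddCommGroup Y] [SecondCountableTopology Y] {F : E n → Y}
    (hF : Continuous F) : MemLp (fun s => F (x s)) 2 (volume.restrict (Ioc 0 t)) := by
  have hc : ContinuousOn (fun s => F (x s)) (Icc 0 t) := hF.comp_continuousOn hx
  obtain ⟨C, hC⟩ := isCompact_Icc.exists_bound_of_continuousOn hc
  refine MemLp.of_bound ((hc.mono Ioc_subset_Icc_self).aestronglyMeasurable measurableSet_Ioc) C ?_
  filter_upwards [ae_restrict_mem measurableSet_Ioc] with s hs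
  exact hC s (Ioc_subset_Icc_self hs)

lemma IsSolution.memLp_comp (h : IsSolution S T x₀ u w x) (htT : (t : EReal) < T)
    {Y : Type*} [NormedAddCommGroup Y] [SecondCountableTopology Y] {F : E n → Y}
    (hF : Continuous F) : MemLp (fun s => F (x s)) 2 (volume.restrict (Ioc 0 t)) :=
  memLp_comp_of_continuousOn (h.continuousOn_Icc htT) hF

lemma IsSolution.intervalIntegrable_u (h : IsSolution S T x₀ u w x) (ht : 0 ≤ t)
    (htT : (t : EReal) < T) : IntervalIntegrable u volume 0 t :=
  (intervalIntegrable_iff_integrableOn_Ioc_of_le ht).2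
    ((h.u_mem t ht htT).integrable (by norm_num))

lemma IsSolution.intervalIntegrable_w (h : IsSolution S T x₀ u w x) (ht : 0 ≤ t)
    (htT : (t : EReal) < T) (j : Fin ξ) : IntervalIntegrable (fun s => w s j) volume 0 t :=
  (intervalIntegrable_iff_integrableOn_Ioc_of_le ht).2
    ((EuclideanSpace.proj (𝕜 := ℝ) j).integrable_comp
      ((h.w_mem t ht htT).integrable (by norm_num)))

lemma IsSolution.intervalIntegrable_rhs (h : IsSolution S T x₀ u w x)
    (hS : IsHomogeneousSystem S r r₀ k ϑ) (ht : 0 ≤ t) (htT : (t : EReal) < T) :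
    IntervalIntegrable (fun s => S.rhs (x s) (u s) (w s)) volume 0 t := by
  have hx := h.continuousOn_uIcc ht htT
  have hsum : IntervalIntegrable (fun s => ∑ j, w s j • S.G₂ j (x s)) volume 0 t := by
    have := IntervalIntegrable.sum (μ := volume) (a := 0) (b := t) Finset.univ
      (f := fun j s => w s j • S.G₂ j (x s)) fun j _ =>
        (h.intervalIntegrable_w ht htT j).smul_continuousOn
          ((hS.G₂_cont j).comp_continuousOn hx)
    convert! this using 1
    ext s; simp
  exact ((hS.f_cont.comp_continuousOn hx).intervalIntegrable.add
    ((h.intervalIntegrable_u ht htT).smul_continuousOn (hS.G₁_cont.comp_continuousOn hx))).add hsum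

lemma IsSolution.intervalIntegrable_rate (h : IsSolution S T x₀ u w x)
    (hS : IsHomogeneousSystem S r r₀ k ϑ) (hV : IsValueFunction r r₀ k V) (ht : 0 ≤ t)
    (htT : (t : EReal) < T) :
    IntervalIntegrable (fun s => rate S V (x s) (u s) (w s)) volume 0 t := by
  have hx := h.continuousOn_uIcc ht htT
  have hsum : IntervalIntegrable (fun s => ∑ j, w s j * lieDeriv V (S.G₂ j) (x s)) volume 0 t := by
    have := IntervalIntegrable.sum (μ := volume) (a := 0) (b := t) Finset.univ
      (f := fun j s => w s j * lieDeriv V (S.G₂ j) (x s)) fun j _ =>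
        (h.intervalIntegrable_w ht htT j).mul_continuousOn
          ((hV.continuous_G₂ hS j).comp_continuousOn hx)
    convert! this using 1
    ext s; simp
  exact (((hV.continuous_f hS).comp_continuousOn hx).intervalIntegrable.add
    ((h.intervalIntegrable_u ht htT).mul_continuousOn
      ((hV.continuous_G₁ hS).comp_continuousOn hx))).add hsum

lemma IsSolution.value_sub (h : IsSolution S T x₀ u w x)
    (hS : IsHomogeneousSystem S r r₀ k ϑ) (hV : IsValueFunction r r₀ k V) (ht : 0 ≤ t)
    (htT : (t : EReal) < T) :
    V (x t) - V x₀ = ∫ s in (0 : ℝ)..t, rate S V (x s) (u s) (w s) := by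
  have := sub_eq_integral_fderiv hV.diff hV.pos (hV.continuous hS) ht
    (h.intervalIntegrable_rhs hS ht htT)
    (fun s hs => by rw [h.apply_zero]; exact h.eqn s hs.1 (IsSolution.lt_of_le htT hs.2))
    (h.continuousOn_Icc htT)
    (by simpa only [fderiv_rhs] using h.intervalIntegrable_rate hS hV ht htT)
  simpa only [fderiv_rhs, h.apply_zero] using this

end Solution

end System

/-! ### Degree-zero weights and the feedback laws -/

section Weight

variable {n ξ l : ℕ} {S : ControlSystem n ξ l} {r : Fin n → ℝ} {r₀ k ϑ : ℝ}
  {V R : E n → ℝ}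

/-- A positive weight that is homogeneous of degree zero. -/
structure IsWeight (r : Fin n → ℝ) (R : E n → ℝ) : Prop where
  pos : ∀ x, 0 < R x
  cont : ContinuousOn R {0}ᶜ
  hom : IsHomogeneousFn r 0 R

lemma IsWeight.exists_le (hR : IsWeight r R) (hr : ∀ i, 0 < r i) :
    ∃ C, ∀ x, ‖R x‖ ≤ C := by
  obtain ⟨C, -, hC⟩ := hR.hom.exists_abs_le hr hR.cont
  refine ⟨max C |R 0|, fun x => ?_⟩
  rcases eq_or_ne x 0 with rfl | hx
  · exact le_max_right _ _
  · have := hC x hx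
    rw [Real.rpow_zero, mul_one] at this
    exact this.trans (le_max_left _ _)

lemma IsWeight.measurable (hR : IsWeight r R) : Measurable R :=
  measurable_of_continuousOn_compl_singleton 0 hR.cont

lemma IsWeight.continuousOn_inv (hR : IsWeight r R) : ContinuousOn (fun x => (R x)⁻¹) {0}ᶜ :=
  hR.cont.inv₀ fun x _ => (hR.pos x).ne'

lemma hom_optLaw (hS : IsHomogeneousSystem S r r₀ k ϑ) (hV : IsValueFunction r r₀ k V)
    (hR : IsWeight r R) (κ β : ℝ) : IsHomogeneousFn r (k + r₀) (optLaw S V R ϑ κ β) :=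
  ((hR.hom.inv.const_mul _).mul (hV.hom_G₁ hS)).congr_degree (zero_add _)

lemma optLaw_zero (hV : IsPosDef V) (κ β : ℝ) : optLaw S V R ϑ κ β 0 = 0 := by
  simp [optLaw, lieDeriv_zero hV]

lemma continuousOn_optLaw (hS : IsHomogeneousSystem S r r₀ k ϑ) (hV : IsValueFunction r r₀ k V)
    (hR : IsWeight r R) (κ β : ℝ) : ContinuousOn (optLaw S V R ϑ κ β) {0}ᶜ :=
  (continuousOn_const.mul hR.continuousOn_inv).mul (hV.continuous_G₁ hS).continuousOn

lemma continuous_optLaw (hS : IsHomogeneousSystem S r r₀ k ϑ) (hV : IsValueFunction r r₀ k V)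
    (hR : IsWeight r R) (κ β : ℝ) : Continuous (optLaw S V R ϑ κ β) :=
  (hom_optLaw hS hV hR κ β).continuous hS.r_pos hS.degree_pos
    (continuousOn_optLaw hS hV hR κ β) (optLaw_zero hV.pos κ β)

/-! ### The decay rate of the auxiliary system -/

/-- The penalty `R⁻¹ (L_{G₁} V)²`. -/
noncomputable def controlPenalty (S : ControlSystem n ξ l) (V R : E n → ℝ) (x : E n) : ℝ :=
  (R x)⁻¹ * (lieDeriv V S.G₁ x * lieDeriv V S.G₁ x)

lemma controlPenalty_nonneg (hR : IsWeight r R) (x : E n) : 0 ≤ controlPenalty S V R x :=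
  mul_nonneg (inv_nonneg.2 (hR.pos x).le) (mul_self_nonneg _)

lemma hom_controlPenalty (hS : IsHomogeneousSystem S r r₀ k ϑ) (hV : IsValueFunction r r₀ k V)
    (hR : IsWeight r R) : IsHomogeneousFn r (2 * k + 2 * r₀) (controlPenalty S V R) :=
  (hR.hom.inv.mul ((hV.hom_G₁ hS).mul (hV.hom_G₁ hS))).congr_degree (by ring)

lemma continuousOn_controlPenalty (hS : IsHomogeneousSystem S r r₀ k ϑ)
    (hV : IsValueFunction r r₀ k V) (hR : IsWeight r R) :
    ContinuousOn (controlPenalty S V R) {0}ᶜ :=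
  hR.continuousOn_inv.mul ((hV.continuous_G₁ hS).mul (hV.continuous_G₁ hS)).continuousOn

/-- The derivative of `V` along `ẋ = f̃(x) + G₁(x) α(x)` when `ℓ_γ(2 s) = μ s²`. -/
noncomputable def auxDecay (S : ControlSystem n ξ l) (V R : E n → ℝ) (ϑ μ κ : ℝ) (x : E n) : ℝ :=
  lieDeriv V S.f x + μ * ‖lieG₂ S V x‖ ^ 2 - κ / (2 * ϑ ^ 2) * controlPenalty S V R x

lemma hom_auxDecay (hS : IsHomogeneousSystem S r r₀ k ϑ) (hV : IsValueFunction r r₀ k V)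
    (hR : IsWeight r R) (μ κ : ℝ) :
    IsHomogeneousFn r (2 * k + 2 * r₀) (auxDecay S V R ϑ μ κ) :=
  ((hV.hom_f hS).add ((hV.hom_norm_lieG₂_sq hS).const_mul μ)).sub
    ((hom_controlPenalty hS hV hR).const_mul _)

lemma continuousOn_auxDecay (hS : IsHomogeneousSystem S r r₀ k ϑ) (hV : IsValueFunction r r₀ k V)
    (hR : IsWeight r R) (μ κ : ℝ) : ContinuousOn (auxDecay S V R ϑ μ κ) {0}ᶜ :=
  ((hV.continuous_f hS).add
      (continuous_const.mul ((hV.continuous_lieG₂ hS).norm.pow 2))).continuousOn.sub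
    (continuousOn_const.mul (continuousOn_controlPenalty hS hV hR))

lemma baseLaw_mul (κ : ℝ) (x : E n) :
    lieDeriv V S.G₁ x * baseLaw S V R ϑ κ x = -(κ / (2 * ϑ ^ 2)) * controlPenalty S V R x := by
  rw [baseLaw, controlPenalty]; ring

lemma optLaw_mul (κ β : ℝ) (x : E n) :
    optLaw S V R ϑ κ β x * lieDeriv V S.G₁ x
      = -(β * κ / (2 * ϑ ^ 2)) * controlPenalty S V R x := by
  rw [optLaw, controlPenalty]; ring

lemma lieDeriv_auxDrift {γ : ℝ → ℝ} {μ : ℝ}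
    (hℓ : ∀ s, 0 ≤ s → legendre γ (2 * s) = μ * s ^ 2) {x : E n} (hx : x ≠ 0) :
    fderiv ℝ V x (auxDrift S V γ x) = lieDeriv V S.f x + μ * ‖lieG₂ S V x‖ ^ 2 := by
  rw [auxDrift, if_neg hx, map_add, map_sum, hℓ _ (norm_nonneg _)]
  have h1 : ∀ j, fderiv ℝ V x ((μ * ‖lieG₂ S V x‖ ^ 2 / ‖lieG₂ S V x‖ ^ 2 * lieG₂ S V x j) •
      S.G₂ j x) = μ * ‖lieG₂ S V x‖ ^ 2 / ‖lieG₂ S V x‖ ^ 2 * lieDeriv V (S.G₂ j) x ^ 2 := by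
    intro j
    rw [map_smul, smul_eq_mul, lieG₂_apply]
    simp only [lieDeriv]
    ring
  simp only [h1, ← Finset.mul_sum]
  rw [← norm_lieG₂_sq, lieDeriv]
  -- Where `L_{G₂}V` vanishes, division by zero gives `0`, which agrees with `μ * 0 ^ 2`.
  by_cases h0 : ‖lieG₂ S V x‖ = 0
  · simp [h0]
  · field_simp

lemma auxDecay_eq {γ : ℝ → ℝ} {μ : ℝ} (hℓ : ∀ s, 0 ≤ s → legendre γ (2 * s) = μ * s ^ 2)
    (κ : ℝ) {x : E n} (hx : x ≠ 0) :
    lieDeriv V (auxDrift S V γ) x + lieDeriv V S.G₁ x * baseLaw S V R ϑ κ x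
      = auxDecay S V R ϑ μ κ x := by
  rw [baseLaw_mul, lieDeriv, lieDeriv_auxDrift hℓ hx, auxDecay]; ring

lemma stabilizesAux_iff {γ : ℝ → ℝ} {μ : ℝ}
    (hℓ : ∀ s, 0 ≤ s → legendre γ (2 * s) = μ * s ^ 2) (κ : ℝ) :
    StabilizesAux S V γ (baseLaw S V R ϑ κ) ↔ ∀ x ≠ 0, auxDecay S V R ϑ μ κ x < 0 := by
  refine forall₂_congr fun x hx => ?_
  rw [← auxDecay_eq hℓ κ hx]
  simp only [lieDeriv, map_add, map_smul, smul_eq_mul]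
  rw [mul_comm]

lemma exists_auxDecay_le (hS : IsHomogeneousSystem S r r₀ k ϑ) (hV : IsValueFunction r r₀ k V)
    (hR : IsWeight r R) {μ κ : ℝ} (hneg : ∀ x ≠ 0, auxDecay S V R ϑ μ κ x < 0) :
    ∃ c, 0 < c ∧ ∀ x ≠ 0, auxDecay S V R ϑ μ κ x ≤ -(c * homNorm r x ^ (2 * k + 2 * r₀)) := by
  obtain ⟨c, hc, h⟩ := (hom_auxDecay hS hV hR μ κ).neg.exists_le hS.r_pos
    (continuousOn_auxDecay hS hV hR μ κ).neg (fun x hx => neg_pos.2 (hneg x hx))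
  exact ⟨c, hc, fun x hx => le_neg.1 (h x hx)⟩

/-- For large gains the decay of a stabilized auxiliary system dominates the output penalty. -/
lemma exists_gain_threshold (hS : IsHomogeneousSystem S r r₀ k ϑ)
    (hV : IsValueFunction r r₀ k V) (hR : IsWeight r R) (μ : ℝ) :
    ∃ κ₀ : ℝ, 0 < κ₀ ∧ ∀ κ, κ₀ < κ → (∀ x ≠ 0, auxDecay S V R ϑ μ κ x < 0) →
      ∀ x ≠ 0, R x * ‖S.h x‖ ^ 2 < -κ * auxDecay S V R ϑ μ κ x := by
  by_cases hex : ∃ κ₁, ∀ x ≠ 0, auxDecay S V R ϑ μ κ₁ x < 0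
  · obtain ⟨κ₁, hκ₁⟩ := hex
    obtain ⟨c, hc, hdec⟩ := exists_auxDecay_le hS hV hR hκ₁
    obtain ⟨C, hC, hout⟩ := (hR.hom.mul hS.hom_norm_h_sq).exists_abs_le hS.r_pos
      (hR.cont.mul (hS.h_cont.norm.pow 2).continuousOn)
    rw [zero_add] at hout
    -- `auxDecay` is nonincreasing in the gain, so the decay constant `c` of one stabilizing gain
    -- `κ₁` serves every larger one; `κ > C / c` then makes `κ * c` exceed the output constant `C`.
    -- It also makes `κ` positive, which `κ₁` need not be.
    refine ⟨max κ₁ (C / c), lt_max_of_lt_right (by positivity), fun κ hκ _ x hx => ?_⟩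
    have hκ1 : κ₁ < κ := (le_max_left _ _).trans_lt hκ
    have hκ2 : C < κ * c := (div_lt_iff₀ hc).1 ((le_max_right _ _).trans_lt hκ)
    have hκ0 : 0 < κ := by
      have : 0 < C / c := by positivity
      exact this.trans ((le_max_right _ _).trans_lt hκ)
    have hN : 0 < homNorm r x ^ (2 * k + 2 * r₀) := Real.rpow_pos_of_pos (homNorm_pos r hx) _
    have h1 : auxDecay S V R ϑ μ κ x ≤ auxDecay S V R ϑ μ κ₁ x := by
      have h2 := controlPenalty_nonneg (S := S) (V := V) hR x
      have h3 : κ₁ / (2 * ϑ ^ 2) ≤ κ / (2 * ϑ ^ 2) := by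
        have := hS.ϑ_pos
        gcongr
      unfold auxDecay
      nlinarith
    have h4 := (le_abs_self _).trans (hout x hx)
    have h5 := hdec x hx
    calc R x * ‖S.h x‖ ^ 2 ≤ C * homNorm r x ^ (2 * k + 2 * r₀) := h4
      _ < κ * c * homNorm r x ^ (2 * k + 2 * r₀) := by gcongr
      _ = κ * (c * homNorm r x ^ (2 * k + 2 * r₀)) := by ring
      _ ≤ κ * -auxDecay S V R ϑ μ κ x := by gcongr; linarith
      _ = _ := by ring
  -- If no gain stabilizes the auxiliary system, any threshold works vacuously.
  · exact ⟨1, one_pos, fun κ _ h => absurd ⟨κ, h⟩ hex⟩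

/-- Young's inequality with weight `μ` splits the disturbance term into `μ |L_{G₂}V|²`, which is
already part of `auxDecay`, and `|w|² / (4μ)`. The excess gain `β - 1` only adds decay. -/
lemma rate_optLaw_le (hR : IsWeight r R) {μ κ β : ℝ} (hμ : 0 < μ) (hκ : 0 < κ) (hβ : 1 ≤ β)
    (x : E n) (w : E ξ) :
    rate S V x (optLaw S V R ϑ κ β x) w
      ≤ auxDecay S V R ϑ μ κ x + ‖w‖ ^ 2 / (4 * μ) := by
  rw [rate_eq_inner, optLaw_mul, auxDecay]
  have h1 : 0 ≤ (β - 1) * (κ / (2 * ϑ ^ 2) * controlPenalty S V R x) := by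
    have := controlPenalty_nonneg (S := S) (V := V) hR x
    have : 0 ≤ β - 1 := by linarith
    positivity
  have h2 : inner ℝ w (lieG₂ S V x) ≤ ‖w‖ * ‖lieG₂ S V x‖ := real_inner_le_norm _ _
  have h3 : ‖w‖ * ‖lieG₂ S V x‖ ≤ μ * ‖lieG₂ S V x‖ ^ 2 + ‖w‖ ^ 2 / (4 * μ) := by
    have : 0 ≤ (2 * μ * ‖lieG₂ S V x‖ - ‖w‖) ^ 2 / (4 * μ) := by positivity
    have h : (2 * μ * ‖lieG₂ S V x‖ - ‖w‖) ^ 2 / (4 * μ)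
        = μ * ‖lieG₂ S V x‖ ^ 2 + ‖w‖ ^ 2 / (4 * μ) - ‖w‖ * ‖lieG₂ S V x‖ := by
      field_simp; ring
    linarith
  have h4 : β * κ / (2 * ϑ ^ 2) * controlPenalty S V R x
      = κ / (2 * ϑ ^ 2) * controlPenalty S V R x
        + (β - 1) * (κ / (2 * ϑ ^ 2) * controlPenalty S V R x) := by ring
  linarith

/-! ### Completing the squares in the cost -/

/-- The deviation of the control and the disturbance from their saddle point values. -/
noncomputable def saddleGap (S : ControlSystem n ξ l) (V R : E n → ℝ) (ϑ μ κ β lam : ℝ)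
    (x : E n) (u : ℝ) (w : E ξ) : ℝ :=
  2 * ϑ ^ 2 / κ * (R x * (u - optLaw S V R ϑ κ β x) ^ 2)
    - β / (lam * μ) * ‖w - (lam * μ) • lieG₂ S V x‖ ^ 2

lemma lBar_eq {γ : ℝ → ℝ} {μ : ℝ} (hV : IsPosDef V)
    (hℓ : ∀ s, 0 ≤ s → legendre γ (2 * s) = μ * s ^ 2) (κ β lam : ℝ) (x : E n) :
    lBar S V γ R ϑ κ β lam x = -2 * β * auxDecay S V R ϑ μ κ x
      + β * (2 - lam) * (μ * ‖lieG₂ S V x‖ ^ 2)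
      + β * (β - 2) * (κ / (2 * ϑ ^ 2) * controlPenalty S V R x) := by
  rcases eq_or_ne x 0 with rfl | hx
  · simp [lBar, auxDecay, controlPenalty, lieDeriv_zero hV, lieG₂_zero hV]
  · rw [lBar, if_neg hx, auxDecay_eq hℓ κ hx, hℓ _ (norm_nonneg _), baseLaw_mul]
    ring

/-- Since `h` is orthogonal to `d`, the output penalty contributes `ϑ² u² R / κ`, doubling `R₁ u²`;
the minimizer over `u` is then `α*`. The terms linear in `u` and `w` cancel against `2 β V'`, and
`l` is chosen so that the terms in `x` alone cancel as well. -/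
lemma runningCost_eq (hS : IsHomogeneousSystem S r r₀ k ϑ) (hV : IsPosDef V)
    (hR : IsWeight r R) {γ : ℝ → ℝ} {μ : ℝ} (hμ : 0 < μ)
    (hγ : ∀ s, 0 ≤ s → γ s = s ^ 2 / μ)
    (hℓ : ∀ s, 0 ≤ s → legendre γ (2 * s) = μ * s ^ 2) {κ β lam : ℝ} (hκ : 0 < κ)
    (hlam : 0 < lam) (x : E n) (u : ℝ) (w : E ξ) :
    runningCost S (explicitWeights S V γ R ϑ κ β lam) x u w
      = saddleGap S V R ϑ μ κ β lam x u w - 2 * β * rate S V x u w := by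
  have hout : (fun i => S.output x u i) ⬝ᵥ
      ((1 / κ * R x) • (1 : Matrix (Fin l) (Fin l) ℝ)).mulVec (fun i => S.output x u i)
      = 1 / κ * R x * (‖S.h x‖ ^ 2 + ϑ ^ 2 * u ^ 2) := by
    rw [← hS.norm_output_sq, Matrix.smul_mulVec, Matrix.one_mulVec, dotProduct_smul,
      EuclideanSpace.real_norm_sq_eq, smul_eq_mul]
    simp [dotProduct, sq]
  have hw : ‖w - (lam * μ) • lieG₂ S V x‖ ^ 2 = ‖w‖ ^ 2
      - 2 * (lam * μ) * inner ℝ w (lieG₂ S V x) + (lam * μ) ^ 2 * ‖lieG₂ S V x‖ ^ 2 := by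
    rw [norm_sub_sq_real, inner_smul_right, norm_smul, mul_pow, Real.norm_eq_abs, sq_abs]
    ring
  simp only [runningCost, explicitWeights, hout, saddleGap]
  rw [hγ _ (by positivity), lBar_eq hV hℓ, auxDecay, rate_eq_inner, hw, optLaw, controlPenalty]
  have := (hR.pos x).ne'
  have := hS.ϑ_pos.ne'
  field_simp
  ring

section Solution

variable {T : EReal} {x₀ : E n} {u : ℝ → ℝ} {w : ℝ → E ξ} {x : ℝ → E n} {t : ℝ}

lemma IsSolution.integrableOn_disturbanceGap (h : IsSolution S T x₀ u w x)
    (hS : IsHomogeneousSystem S r r₀ k ϑ) (hV : IsValueFunction r r₀ k V) (c : ℝ)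
    (ht : 0 ≤ t) (htT : (t : EReal) < T) :
    IntegrableOn (fun s => ‖w s - c • lieG₂ S V (x s)‖ ^ 2) (Ioc 0 t) :=
  ((h.w_mem t ht htT).sub
    ((h.memLp_comp htT (hV.continuous_lieG₂ hS)).const_smul c)).integrable_norm_pow two_ne_zero

lemma IsSolution.integrableOn_controlGap (h : IsSolution S T x₀ u w x)
    (hS : IsHomogeneousSystem S r r₀ k ϑ) (hV : IsValueFunction r r₀ k V)
    (hR : IsWeight r R) (κ β : ℝ) (ht : 0 ≤ t) (htT : (t : EReal) < T) :
    IntegrableOn (fun s => R (x s) * (u s - optLaw S V R ϑ κ β (x s)) ^ 2) (Ioc 0 t) := by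
  obtain ⟨C, hC⟩ := hR.exists_le hS.r_pos
  have hx : AEMeasurable x (volume.restrict (Ioc 0 t)) :=
    ((h.continuousOn_Icc htT).mono Ioc_subset_Icc_self).aemeasurable measurableSet_Ioc
  -- `R` may be discontinuous at the origin, but it is measurable and bounded, which is enough along
  -- a curve that passes through `0`.
  refine Integrable.bdd_mul (c := C) ?_
    (hR.measurable.comp_aemeasurable hx).aestronglyMeasurable (ae_of_all _ fun s => hC _)
  exact ((h.u_mem t ht htT).sub (h.memLp_comp htT (continuous_optLaw hS hV hR κ β))).integrable_sq

lemma IsSolution.intervalIntegrable_saddleGap (h : IsSolution S T x₀ u w x)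
    (hS : IsHomogeneousSystem S r r₀ k ϑ) (hV : IsValueFunction r r₀ k V)
    (hR : IsWeight r R) (μ κ β lam : ℝ) (ht : 0 ≤ t) (htT : (t : EReal) < T) :
    IntervalIntegrable (fun s => saddleGap S V R ϑ μ κ β lam (x s) (u s) (w s)) volume 0 t :=
  (intervalIntegrable_iff_integrableOn_Ioc_of_le ht).2
    (((h.integrableOn_controlGap hS hV hR κ β ht htT).const_mul _).sub
      ((h.integrableOn_disturbanceGap hS hV (lam * μ) ht htT).const_mul _))

lemma IsSolution.costUpTo_eq (h : IsSolution S T x₀ u w x)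
    (hS : IsHomogeneousSystem S r r₀ k ϑ) (hV : IsValueFunction r r₀ k V)
    (hR : IsWeight r R) {γ : ℝ → ℝ} {μ : ℝ} (hμ : 0 < μ)
    (hγ : ∀ s, 0 ≤ s → γ s = s ^ 2 / μ)
    (hℓ : ∀ s, 0 ≤ s → legendre γ (2 * s) = μ * s ^ 2) {κ β lam : ℝ} (hκ : 0 < κ)
    (hlam : 0 < lam) (ht : 0 ≤ t) (htT : (t : EReal) < T) :
    costUpTo S (explicitWeights S V γ R ϑ κ β lam) u w x t
      = 2 * β * V x₀
        + ∫ s in (0 : ℝ)..t, saddleGap S V R ϑ μ κ β lam (x s) (u s) (w s) := by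
  have h1 := h.value_sub hS hV ht htT
  simp only [costUpTo, runningCost_eq hS hV.pos hR hμ hγ hℓ hκ hlam]
  rw [intervalIntegral.integral_sub (h.intervalIntegrable_saddleGap hS hV hR μ κ β lam ht htT)
    ((h.intervalIntegrable_rate hS hV ht htT).const_mul _), intervalIntegral.integral_const_mul,
    ← h1]
  simp only [explicitWeights]
  ring

end Solution

end Weight

/-! ### Input-to-state stability -/

/-- A nonnegative function whose derivative is at most `-a v ^ p` while `v ≥ b`. -/
lemma le_or_rpow_le_of_decay {v D : ℝ → ℝ} {t a b p : ℝ} (ht : 0 ≤ t) (ha : 0 < a) (hp : 0 < p)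
    (hv0 : ∀ s, 0 ≤ v s) (hvc : ContinuousOn v (Icc 0 t))
    (hD : IntervalIntegrable D volume 0 t)
    (hv : ∀ s ∈ Icc 0 t, v s - v 0 = ∫ τ in (0 : ℝ)..s, D τ)
    (hdec : ∀ᵐ s, s ∈ Ioc 0 t → b ≤ v s → D s ≤ -(a * v s ^ p)) :
    v t ≤ b ∨ (1 + t) * v t ^ p ≤ v 0 ^ p + v 0 / a := by
  have hsub : ∀ s ∈ Icc 0 t, IntervalIntegrable D volume 0 s := fun s hs =>
    hD.mono_set (by rw [uIcc_of_le hs.1, uIcc_of_le ht]; exact Icc_subset_Icc_right hs.2)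
  have hsub' : ∀ s ∈ Icc 0 t, IntervalIntegrable D volume s t := fun s hs =>
    hD.mono_set (by rw [uIcc_of_le hs.2, uIcc_of_le ht]; exact Icc_subset_Icc_left hs.1)
  have hdiff : ∀ s ∈ Icc 0 t, v t - v s = ∫ τ in s..t, D τ := by
    intro s hs
    have h1 := hv t (right_mem_Icc.2 ht)
    have h2 := hv s hs
    have h3 := intervalIntegral.integral_add_adjacent_intervals (hsub s hs) (hsub' s hs)
    linarith
  have hmono : ∀ s ∈ Icc 0 t, ∀ C, 0 ≤ C →
      (∀ τ ∈ Ioc s t, b ≤ v τ ∧ C ≤ a * v τ ^ p) → v t - v s ≤ -(C * (t - s)) := by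
    intro s hs C _ hτ
    rw [hdiff s hs]
    have := intervalIntegral.integral_mono_ae_restrict (μ := volume) hs.2 (hsub' s hs)
      (intervalIntegrable_const (c := -C)) (by
        rw [EventuallyLE, ae_restrict_iff' measurableSet_Icc]
        filter_upwards [hdec, Measure.ae_ne volume s] with τ h1 h2 h3
        have h4 : τ ∈ Ioc s t := ⟨lt_of_le_of_ne h3.1 (Ne.symm h2), h3.2⟩
        have h5 := h1 ⟨hs.1.trans_lt h4.1, h4.2⟩ (hτ τ h4).1
        have h6 := (hτ τ h4).2
        linarith)
    rw [intervalIntegral.integral_const, smul_eq_mul] at this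
    linarith
  -- If the level `b` is reached, `v` does not increase after the last time it is at most `b`.
  -- Otherwise `v` is nonincreasing on `[0, t]`, so its slope is at most `-a * v t ^ p` throughout
  -- and `t * a * v t ^ p ≤ v 0`; no comparison equation has to be solved.
  by_cases hex : ∃ τ ∈ Icc 0 t, v τ ≤ b
  · left
    let A := {τ ∈ Icc 0 t | v τ ≤ b}
    have hA : IsCompact A := by
      have : IsClosed A := hvc.preimage_isClosed_of_isClosed isClosed_Icc isClosed_Iic
      exact isCompact_Icc.of_isClosed_subset this fun τ h => h.1
    obtain ⟨s, hsA, hsmax⟩ := hA.exists_isGreatest hex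
    have h1 := hmono s hsA.1 0 le_rfl fun τ hτ => by
      have h2 : b < v τ := by
        by_contra! h
        exact absurd (hsmax ⟨⟨hsA.1.1.trans hτ.1.le, hτ.2⟩, h⟩) (not_le.2 hτ.1)
      have := hv0 τ
      exact ⟨h2.le, by positivity⟩
    have h2 := hsA.2
    linarith
  · push Not at hex
    right
    have hanti : ∀ s ∈ Icc 0 t, v t ≤ v s := by
      intro s hs
      have := hmono s hs 0 le_rfl fun τ hτ => by
        have := hv0 τ
        exact ⟨(hex τ ⟨hs.1.trans hτ.1.le, hτ.2⟩).le, by positivity⟩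
      linarith
    have h1 := hmono 0 (left_mem_Icc.2 ht) (a * v t ^ p) (by have := hv0 t; positivity)
      fun τ hτ => ⟨(hex τ ⟨hτ.1.le, hτ.2⟩).le,
        mul_le_mul_of_nonneg_left
          (Real.rpow_le_rpow (hv0 t) (hanti τ ⟨hτ.1.le, hτ.2⟩) hp.le) ha.le⟩
    have h2 : v t ^ p ≤ v 0 ^ p :=
      Real.rpow_le_rpow (hv0 t) (hanti 0 (left_mem_Icc.2 ht)) hp.le
    have h3 : t * v t ^ p ≤ v 0 / a := by
      rw [le_div_iff₀ ha]
      have := hv0 t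
      nlinarith
    linarith

lemma ClassK.const_mul {g : ℝ → ℝ} (hg : ClassK g) {c : ℝ} (hc : 0 < c) :
    ClassK (fun s => c * g s) :=
  ⟨by simp [hg.1], continuousOn_const.mul hg.2.1, fun _ ha _ hb hab =>
    mul_lt_mul_of_pos_left (hg.2.2 ha hb hab) hc⟩

lemma ClassK.add {f g : ℝ → ℝ} (hf : ClassK f) (hg : ClassK g) :
    ClassK (fun s => f s + g s) :=
  ⟨by simp [hf.1, hg.1], hf.2.1.add hg.2.1, fun _ ha _ hb hab =>
    add_lt_add (hf.2.2 ha hb hab) (hg.2.2 ha hb hab)⟩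

lemma classK_rpow {p : ℝ} (hp : 0 < p) : ClassK (fun s => s ^ p) := by
  simpa using (classKInf_const_mul_rpow one_pos hp).1

/-- The `KL` function built from two class `K` functions, a continuous one applied outside of a
power of `B(s) / (1 + t)`. -/
lemma classKL_of_classK {A B : ℝ → ℝ} (hA : ClassK A) (hAc : Continuous A) (hB : ClassK B)
    {p : ℝ} (hp : 0 < p) : ClassKL (fun s t => A ((B s / (1 + t)) ^ p)) := by
  refine ⟨fun t ht => ?_, fun s hs => ⟨?_, ?_⟩⟩
  · have h : ClassK (fun s => B s / (1 + t)) := by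
      simpa [div_eq_inv_mul] using hB.const_mul (c := (1 + t)⁻¹) (by positivity)
    exact hA.comp ((classK_rpow hp).comp h)
  · intro t₁ ht₁ t₂ ht₂ h12
    rw [mem_Ici] at ht₁ ht₂
    have hBs := hB.nonneg hs
    refine hA.2.2.monotoneOn (mem_Ici.2 (by positivity)) (mem_Ici.2 (by positivity)) ?_
    gcongr
  · have h1 : Tendsto (fun t : ℝ => B s / (1 + t)) atTop (𝓝 0) :=
      tendsto_const_nhds.div_atTop (tendsto_atTop_add_const_left _ _ tendsto_id)
    have h2 : Continuous fun y : ℝ => A (y ^ p) := hAc.comp (Real.continuous_rpow_const hp.le)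
    have h3 := (h2.tendsto 0).comp h1
    rw [Real.zero_rpow hp.ne', hA.1] at h3
    exact h3

section ISS

variable {n ξ l : ℕ} {S : ControlSystem n ξ l} {r : Fin n → ℝ} {r₀ k ϑ : ℝ}
  {V R : E n → ℝ}

/-- `V` dominates a multiple of `homNorm ^ (k + 2 r₀)`, and each coordinate is bounded by `homNorm ^
rᵢ`; inverting the first power gives `A` explicitly. -/
lemma IsValueFunction.exists_norm_le (hV : IsValueFunction r r₀ k V)
    (hS : IsHomogeneousSystem S r r₀ k ϑ) :
    ∃ A, ClassK A ∧ Continuous A ∧ ∀ x, ‖x‖ ≤ A (V x) := by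
  have hm : 0 < k + 2 * r₀ := by have := hS.degree_pos; have := hS.r₀_pos; linarith
  obtain ⟨c, hc, hcV⟩ := hV.hom.exists_le hS.r_pos hV.diff.continuousOn hV.pos.2
  have hbase : ClassK (fun s : ℝ => (c⁻¹ * s) ^ (k + 2 * r₀)⁻¹) :=
    (classK_rpow (inv_pos.2 hm)).comp
      (by simpa using (classK_rpow one_pos).const_mul (inv_pos.2 hc))
  refine ⟨fun s => ∑ i, ((c⁻¹ * s) ^ (k + 2 * r₀)⁻¹) ^ r i,
    classK_sum hS.univ_nonempty fun i _ => (classK_rpow (hS.r_pos i)).comp hbase, ?_, fun x => ?_⟩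
  · refine continuous_finsetSum _ fun i _ => ?_
    exact ((continuous_const.mul continuous_id).rpow_const fun _ =>
      Or.inr (inv_pos.2 hm).le).rpow_const fun _ => Or.inr (hS.r_pos i).le
  · refine (norm_le_sum_homNorm_rpow hS.r_pos x).trans ?_
    refine Finset.sum_le_sum fun i _ => Real.rpow_le_rpow (homNorm_nonneg r x) ?_ (hS.r_pos i).le
    rcases eq_or_ne x 0 with rfl | hx
    · rw [homNorm_zero hS.r_pos]
      have := hV.pos.nonneg 0
      positivity
    · have h1 : homNorm r x ^ (k + 2 * r₀) ≤ c⁻¹ * V x := by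
        rw [inv_mul_eq_div, le_div_iff₀ hc, mul_comm]
        exact hcV x hx
      calc homNorm r x = (homNorm r x ^ (k + 2 * r₀)) ^ (k + 2 * r₀)⁻¹ := by
            rw [← Real.rpow_mul (homNorm_nonneg r x), mul_inv_cancel₀ hm.ne', Real.rpow_one]
        _ ≤ _ := Real.rpow_le_rpow (Real.rpow_nonneg (homNorm_nonneg r x) _) h1 (inv_pos.2 hm).le

lemma IsValueFunction.exists_le_norm (hV : IsValueFunction r r₀ k V)
    (hS : IsHomogeneousSystem S r r₀ k ϑ) :
    ∃ B, ClassK B ∧ ∀ x, V x ≤ B ‖x‖ := by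
  have hm : 0 < k + 2 * r₀ := by have := hS.degree_pos; have := hS.r₀_pos; linarith
  obtain ⟨C, hC, hCV⟩ := hV.hom.exists_abs_le hS.r_pos hV.diff.continuousOn
  have hK : ClassK (fun s => C * (∑ i, s ^ (1 / r i)) ^ (k + 2 * r₀)) :=
    ((classK_rpow hm).comp (classK_sum hS.univ_nonempty fun i _ =>
      classK_rpow (one_div_pos.2 (hS.r_pos i)))).const_mul hC
  refine ⟨_, hK, fun x => ?_⟩
  rcases eq_or_ne x 0 with rfl | hx
  · rw [hV.pos.1]; exact hK.nonneg (norm_nonneg _)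
  · refine ((le_abs_self _).trans (hCV x hx)).trans ?_
    have := homNorm_le_sum_norm_rpow hS.r_pos x
    have := homNorm_nonneg r x
    gcongr

/-- The exponent `p` is the quotient of the degrees of `auxDecay` and `V`. The factor `2` reserves
half of the decay for absorbing the disturbance. -/
lemma exists_auxDecay_le_value (hS : IsHomogeneousSystem S r r₀ k ϑ)
    (hV : IsValueFunction r r₀ k V) (hR : IsWeight r R) {μ κ : ℝ}
    (hneg : ∀ x ≠ 0, auxDecay S V R ϑ μ κ x < 0) :
    ∃ a p : ℝ, 0 < a ∧ 0 < p ∧ ∀ x, auxDecay S V R ϑ μ κ x ≤ -(2 * a * V x ^ p) := by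
  have hm : 0 < k + 2 * r₀ := by have := hS.degree_pos; have := hS.r₀_pos; linarith
  have hq : 0 < 2 * k + 2 * r₀ := by have := hS.degree_pos; linarith
  obtain ⟨C, hC, hCV⟩ := hV.hom.exists_abs_le hS.r_pos hV.diff.continuousOn
  obtain ⟨c, hc, hdec⟩ := exists_auxDecay_le hS hV hR hneg
  set p := (2 * k + 2 * r₀) / (k + 2 * r₀) with hp
  have hp0 : 0 < p := by positivity
  have hCp : 0 < C ^ p := Real.rpow_pos_of_pos hC p
  refine ⟨c / (2 * C ^ p), p, by positivity, hp0, fun x => ?_⟩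
  rcases eq_or_ne x 0 with rfl | hx
  · simp [auxDecay, controlPenalty, lieDeriv_zero hV.pos, lieG₂_zero hV.pos, hV.pos.1,
      Real.zero_rpow hp0.ne']
  · refine (hdec x hx).trans (neg_le_neg ?_)
    have h1 : V x ^ p ≤ C ^ p * homNorm r x ^ (2 * k + 2 * r₀) := by
      calc V x ^ p ≤ (C * homNorm r x ^ (k + 2 * r₀)) ^ p :=
            Real.rpow_le_rpow (hV.pos.nonneg x) ((le_abs_self _).trans (hCV x hx)) hp0.le
        _ = _ := by
            rw [Real.mul_rpow hC.le (Real.rpow_nonneg (homNorm_nonneg r x) _),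
              ← Real.rpow_mul (homNorm_nonneg r x), hp, mul_div_cancel₀ _ hm.ne']
    calc 2 * (c / (2 * C ^ p)) * V x ^ p = c / C ^ p * V x ^ p := by field_simp
      _ ≤ c / C ^ p * (C ^ p * homNorm r x ^ (2 * k + 2 * r₀)) := by gcongr
      _ = _ := by field_simp

lemma ae_norm_le_eLpNorm_top {w : ℝ → E ξ} (hw : MemLp w ⊤ (volume.restrict (Ioi 0))) (t : ℝ) :
    ∀ᵐ s, s ∈ Ioc 0 t → ‖w s‖ ≤ (eLpNorm w ⊤ (volume.restrict (Ioc 0 t))).toReal := by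
  have hw' : MemLp w ⊤ (volume.restrict (Ioc 0 t)) :=
    hw.mono_measure (Measure.restrict_mono Ioc_subset_Ioi_self le_rfl)
  rw [← ae_restrict_iff' measurableSet_Ioc]
  have := ae_le_eLpNormEssSup (f := w) (μ := volume.restrict (Ioc 0 t))
  filter_upwards [this] with s hs
  rw [← eLpNorm_exponent_top] at hs
  have h := ENNReal.toReal_mono hw'.2.ne hs
  rwa [toReal_enorm] at h

/-- Input-to-state stability of the closed loop under the optimal law. -/
theorem isISS_optLaw (hS : IsHomogeneousSystem S r r₀ k ϑ)
    (hV : IsValueFunction r r₀ k V) (hR : IsWeight r R) {μ κ β : ℝ} (hμ : 0 < μ) (hκ : 0 < κ)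
    (hβ : 1 ≤ β) (hneg : ∀ x ≠ 0, auxDecay S V R ϑ μ κ x < 0) :
    IsISS S (optLaw S V R ϑ κ β) := by
  obtain ⟨A, hA, hAc, hAV⟩ := hV.exists_norm_le hS
  obtain ⟨B, hB, hBV⟩ := hV.exists_le_norm hS
  obtain ⟨a, p, ha, hp, hdec⟩ := exists_auxDecay_le_value hS hV hR hneg
  have hB' : ClassK (fun s => B s ^ p + a⁻¹ * B s) :=
    ((classK_rpow hp).comp hB).add (hB.const_mul (inv_pos.2 ha))
  -- This threshold solves `a * b ^ p = M ^ 2 / (4 * μ)`: once `V ≥ b`, half of the decay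
  -- compensates a disturbance bounded by `M`.
  have hb : ClassK (fun M : ℝ => ((4 * μ * a)⁻¹ * M ^ (2 : ℝ)) ^ p⁻¹) :=
    (classK_rpow (inv_pos.2 hp)).comp ((classK_rpow two_pos).const_mul (by positivity))
  refine ⟨_, classKL_of_classK hA hAc hB' (inv_pos.2 hp), _, hA.comp hb, ?_⟩
  intro x₀ w hw T x hx t ht htT
  set M := (eLpNorm w ⊤ (volume.restrict (Ioc 0 t))).toReal with hM
  have hM0 : 0 ≤ M := ENNReal.toReal_nonneg
  set b := ((4 * μ * a)⁻¹ * M ^ (2 : ℝ)) ^ p⁻¹ with hbdef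
  have hb0 : 0 ≤ b := by positivity
  have hbp : a * b ^ p = M ^ 2 / (4 * μ) := by
    rw [hbdef, ← Real.rpow_mul (by positivity), inv_mul_cancel₀ hp.ne', Real.rpow_one,
      Real.rpow_two]
    field_simp
  have hcont : ContinuousOn (fun s => V (x s)) (Icc 0 t) :=
    (hV.continuous hS).comp_continuousOn (hx.continuousOn_Icc htT)
  have hae : ∀ᵐ s, s ∈ Ioc 0 t → b ≤ V (x s) →
      rate S V (x s) (optLaw S V R ϑ κ β (x s)) (w s) ≤ -(a * V (x s) ^ p) := by
    filter_upwards [ae_norm_le_eLpNorm_top hw t] with s hs hst hbs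
    have h1 := rate_optLaw_le (S := S) (V := V) (ϑ := ϑ) hR hμ hκ hβ (x s) (w s)
    have h2 := hdec (x s)
    have h3 : ‖w s‖ ^ 2 / (4 * μ) ≤ M ^ 2 / (4 * μ) := by
      have := hs hst
      gcongr
    have h4 : a * b ^ p ≤ a * V (x s) ^ p := by gcongr
    linarith
  have key := le_or_rpow_le_of_decay (v := fun s => V (x s)) ht.le ha hp
    (fun s => hV.pos.nonneg _) hcont (hx.intervalIntegrable_rate hS hV ht.le htT)
    (fun s hs => by
      rw [hx.apply_zero]
      exact hx.value_sub hS hV hs.1 (IsSolution.lt_of_le htT hs.2)) hae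
  have hAb : 0 ≤ A b := hA.nonneg hb0
  have hBn : 0 ≤ B ‖x₀‖ := hB.nonneg (norm_nonneg _)
  have hη : 0 ≤ ((B ‖x₀‖ ^ p + a⁻¹ * B ‖x₀‖) / (1 + t)) ^ p⁻¹ := by positivity
  refine (hAV (x t)).trans ?_
  rcases key with h | h
  · have h1 := hA.2.2.monotoneOn (mem_Ici.2 (hV.pos.nonneg _)) (mem_Ici.2 hb0) h
    have h2 := hA.nonneg hη
    linarith
  · have hV0 := hBV x₀
    have hVn := hV.pos.nonneg x₀
    simp only [hx.apply_zero] at h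
    have h1 : V (x t) ^ p ≤ (B ‖x₀‖ ^ p + a⁻¹ * B ‖x₀‖) / (1 + t) := by
      rw [le_div_iff₀ (by positivity), mul_comm]
      refine h.trans ?_
      rw [div_eq_inv_mul]
      gcongr
    have h2 : V (x t) ≤ ((B ‖x₀‖ ^ p + a⁻¹ * B ‖x₀‖) / (1 + t)) ^ p⁻¹ := by
      calc V (x t) = (V (x t) ^ p) ^ p⁻¹ := by
            rw [← Real.rpow_mul (hV.pos.nonneg _), mul_inv_cancel₀ hp.ne', Real.rpow_one]
        _ ≤ _ := Real.rpow_le_rpow (Real.rpow_nonneg (hV.pos.nonneg _) _) h1 (inv_pos.2 hp).le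
    have h3 := hA.2.2.monotoneOn (mem_Ici.2 (hV.pos.nonneg _)) (mem_Ici.2 hη) h2
    linarith

end ISS

/-! ### Finite-gain stability -/

section Gain

variable {n ξ l : ℕ} {S : ControlSystem n ξ l} {r : Fin n → ℝ} {r₀ k ϑ : ℝ}
  {V R : E n → ℝ}

/-- Under the law `α*`, `|y|²` is homogeneous of the same degree as `auxDecay`, so on the
homogeneous unit sphere it is at most a multiple of the decay. -/
lemma exists_norm_output_sq_le (hS : IsHomogeneousSystem S r r₀ k ϑ)
    (hV : IsValueFunction r r₀ k V) (hR : IsWeight r R) {μ κ : ℝ} (β : ℝ)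
    (hneg : ∀ x ≠ 0, auxDecay S V R ϑ μ κ x < 0) :
    ∃ K, 0 < K ∧ ∀ x, ‖S.output x (optLaw S V R ϑ κ β x)‖ ^ 2
      ≤ K * -auxDecay S V R ϑ μ κ x := by
  obtain ⟨c, hc, hdec⟩ := exists_auxDecay_le hS hV hR hneg
  have hu := hom_optLaw hS hV hR κ β
  have huc := continuousOn_optLaw hS hV hR κ β
  obtain ⟨C, hC, hout⟩ := (hS.hom_norm_h_sq.add
    (((hu.mul hu).congr_degree (show k + r₀ + (k + r₀) = 2 * k + 2 * r₀ by ring)).const_mul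
      (ϑ ^ 2))).exists_abs_le hS.r_pos
      ((hS.h_cont.norm.pow 2).continuousOn.add (continuousOn_const.mul (huc.mul huc)))
  refine ⟨C / c, by positivity, fun x => ?_⟩
  rw [hS.norm_output_sq]
  rcases eq_or_ne x 0 with rfl | hx
  · simp [auxDecay, controlPenalty, lieDeriv_zero hV.pos, lieG₂_zero hV.pos, hS.h_zero,
      optLaw_zero hV.pos]
  · have h1 := (le_abs_self _).trans (hout x hx)
    have h2 := hdec x hx
    rw [sq (optLaw S V R ϑ κ β x)]
    calc _ ≤ C * homNorm r x ^ (2 * k + 2 * r₀) := h1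
      _ = C / c * (c * homNorm r x ^ (2 * k + 2 * r₀)) := by
        rw [← mul_assoc, div_mul_cancel₀ _ hc.ne']
      _ ≤ C / c * -auxDecay S V R ϑ μ κ x := by gcongr; linarith

lemma ofReal_integral_norm_sq {Y : Type*} [NormedAddCommGroup Y] {m : Measure ℝ} {f : ℝ → Y}
    (hf : MemLp f 2 m) :
    ENNReal.ofReal (∫ s, ‖f s‖ ^ 2 ∂m) = ∫⁻ s, ‖f s‖ₑ ^ 2 ∂m := by
  rw [ofReal_integral_eq_lintegral_ofReal (hf.integrable_norm_pow two_ne_zero)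
    (ae_of_all _ fun s => by positivity)]
  refine lintegral_congr fun s => ?_
  rw [ENNReal.ofReal_pow (norm_nonneg _), ofReal_norm]

lemma eLpNorm_two_sq {Y : Type*} [NormedAddCommGroup Y] {m : Measure ℝ} (f : ℝ → Y) :
    eLpNorm f 2 m ^ 2 = ∫⁻ s, ‖f s‖ₑ ^ 2 ∂m := by
  rw [eLpNorm_eq_lintegral_rpow_enorm_toReal two_ne_zero ENNReal.ofNat_ne_top, ← ENNReal.rpow_two,
    ← ENNReal.rpow_mul]
  simp

/-- Intervals with rational endpoints form a countable directed exhaustion of `[0, T)` up to the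
null set `{0}`, whether `T` is finite or not. -/
lemma setLIntegral_le_of_forall_Ioc {T : EReal} {F : ℝ → ENNReal} {C : ENNReal}
    (h : ∀ t : ℝ, 0 ≤ t → (t : EReal) < T → ∫⁻ s in Ioc 0 t, F s ≤ C) :
    ∫⁻ s in {t : ℝ | 0 ≤ t ∧ (t : EReal) < T}, F s ≤ C := by
  let ι := {q : ℚ // 0 ≤ (q : ℝ) ∧ ((q : ℝ) : EReal) < T}
  have hsub : {t : ℝ | 0 ≤ t ∧ (t : EReal) < T} ⊆ {0} ∪ ⋃ q : ι, Ioc (0 : ℝ) (q.1 : ℝ) := by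
    rintro t ⟨ht, htT⟩
    rcases ht.eq_or_lt with rfl | ht
    · exact Or.inl rfl
    · obtain ⟨q, hq1, hq2⟩ := EReal.lt_iff_exists_rat_btwn.1 htT
      have hq : t < (q : ℝ) := EReal.coe_lt_coe_iff.1 hq1
      exact Or.inr (mem_iUnion.2 ⟨⟨q, (ht.trans hq).le, hq2⟩, ht, hq.le⟩)
  calc _ ≤ ∫⁻ s in {0} ∪ ⋃ q : ι, Ioc (0 : ℝ) (q.1 : ℝ), F s := lintegral_mono_set hsub
    _ ≤ (∫⁻ s in {0}, F s) + ∫⁻ s in ⋃ q : ι, Ioc (0 : ℝ) (q.1 : ℝ), F s :=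
        lintegral_union_le _ _ _
    _ = ∫⁻ s in ⋃ q : ι, Ioc (0 : ℝ) (q.1 : ℝ), F s := by simp
    _ = ⨆ q : ι, ∫⁻ s in Ioc (0 : ℝ) (q.1 : ℝ), F s := by
        refine setLIntegral_iUnion_of_directed _ (Monotone.directed_le ?_)
        intro p q hpq
        exact Ioc_subset_Ioc_right (by exact_mod_cast hpq)
    _ ≤ C := iSup_le fun q => h _ q.2.1 q.2.2

/-- Finite-gain `L₂` stability of the closed loop under the optimal law. -/
theorem isFiniteGainL2_optLaw (hS : IsHomogeneousSystem S r r₀ k ϑ)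
    (hV : IsValueFunction r r₀ k V) (hR : IsWeight r R) {μ κ β : ℝ} (hμ : 0 < μ) (hκ : 0 < κ)
    (hβ : 1 ≤ β) (hneg : ∀ x ≠ 0, auxDecay S V R ϑ μ κ x < 0) :
    IsFiniteGainL2 S (optLaw S V R ϑ κ β) := by
  obtain ⟨K, hK, hout⟩ := exists_norm_output_sq_le hS hV hR β hneg
  refine ⟨√(K / (4 * μ)), Real.sqrt_nonneg _, fun x₀ =>
    ⟨√(K * V x₀), Real.sqrt_nonneg _, fun T w x hx hw => ?_⟩⟩
  set I := {t : ℝ | 0 ≤ t ∧ (t : EReal) < T} with hI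
  have hV0 := hV.pos.nonneg x₀
  have hyc : Continuous fun z => S.output z (optLaw S V R ϑ κ β z) :=
    hS.h_cont.add ((continuous_optLaw hS hV hR κ β).smul continuous_const)
  have hbound : ∀ t : ℝ, 0 ≤ t → (t : EReal) < T →
      ∫⁻ s in Ioc 0 t, ‖S.output (x s) (optLaw S V R ϑ κ β (x s))‖ₑ ^ 2
        ≤ ENNReal.ofReal (K / (4 * μ)) * eLpNorm w 2 (volume.restrict I) ^ 2
          + ENNReal.ofReal (K * V x₀) := by
    intro t ht htT
    have hy := hx.memLp_comp htT hyc
    have hwt := hx.w_mem t ht htT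
    have hrate := hx.intervalIntegrable_rate hS hV ht htT
    have hval := hx.value_sub hS hV ht htT
    rw [intervalIntegral.integral_of_le ht] at hval
    have hw2 := hwt.integrable_norm_pow two_ne_zero
    have hr2 : IntegrableOn (fun s => rate S V (x s) (optLaw S V R ϑ κ β (x s)) (w s))
      (Ioc 0 t) := (intervalIntegrable_iff_integrableOn_Ioc_of_le ht).1 hrate
    have hle : ∫ s in Ioc 0 t, ‖S.output (x s) (optLaw S V R ϑ κ β (x s))‖ ^ 2
        ≤ K / (4 * μ) * (∫ s in Ioc 0 t, ‖w s‖ ^ 2) + K * V x₀ := by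
      have h1 : ∫ s in Ioc 0 t, ‖S.output (x s) (optLaw S V R ϑ κ β (x s))‖ ^ 2
          ≤ ∫ s in Ioc 0 t, (K / (4 * μ) * ‖w s‖ ^ 2
            - K * rate S V (x s) (optLaw S V R ϑ κ β (x s)) (w s)) := by
        refine integral_mono (hy.integrable_norm_pow two_ne_zero)
          ((hw2.const_mul _).sub (hr2.const_mul _)) fun s => ?_
        have h2 := rate_optLaw_le (S := S) (V := V) (ϑ := ϑ) hR hμ hκ hβ (x s) (w s)
        calc _ ≤ K * -auxDecay S V R ϑ μ κ (x s) := hout (x s)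
          _ ≤ K * (‖w s‖ ^ 2 / (4 * μ) - rate S V (x s) (optLaw S V R ϑ κ β (x s)) (w s)) := by
            gcongr; linarith
          _ = _ := by ring
      rw [integral_sub (hw2.const_mul _) (hr2.const_mul _), integral_const_mul,
        integral_const_mul, ← hval] at h1
      have h3 := mul_nonneg hK.le (hV.pos.nonneg (x t))
      linarith
    rw [← ofReal_integral_norm_sq hy]
    refine (ENNReal.ofReal_le_ofReal hle).trans ?_
    rw [ENNReal.ofReal_add (by positivity) (by positivity), ENNReal.ofReal_mul (by positivity),
      ofReal_integral_norm_sq hwt, eLpNorm_two_sq]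
    gcongr
    exact fun s hs => ⟨hs.1.le, IsSolution.lt_of_le htT hs.2⟩
  have hfin := setLIntegral_le_of_forall_Ioc hbound
  rw [← eLpNorm_two_sq] at hfin
  -- The squared estimate passes to norms by `a ^ 2 + b ^ 2 ≤ (a + b) ^ 2`.
  refine (ENNReal.pow_le_pow_left_iff two_ne_zero).1 (hfin.trans ?_)
  have hsq : ∀ z : ℝ, 0 ≤ z → ENNReal.ofReal z = ENNReal.ofReal √z ^ 2 := fun z hz => by
    rw [← ENNReal.ofReal_pow (Real.sqrt_nonneg z), Real.sq_sqrt hz]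
  rw [hsq (K / (4 * μ)) (by positivity), hsq (K * V x₀) (by positivity), ← mul_pow, add_sq]
  gcongr
  exact le_self_add

end Gain

/-! ### The end of the interval of existence -/

lemma eventually_toEnd {T : EReal} {t₀ : ℝ} (h : (t₀ : EReal) < T) :
    ∀ᶠ t in toEnd T, t₀ ≤ t ∧ (t : EReal) < T := by
  induction T with
  | bot => exact absurd h not_lt_bot
  | top =>
    rw [toEnd, if_pos rfl]
    filter_upwards [eventually_ge_atTop t₀] with t ht using ⟨ht, EReal.coe_lt_top t⟩
  | coe T =>
    rw [toEnd, if_neg (EReal.coe_ne_top T), EReal.toReal_coe]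
    filter_upwards [Ioo_mem_nhdsLT (EReal.coe_lt_coe_iff.1 h)] with t ht using
      ⟨ht.1.le, EReal.coe_lt_coe_iff.2 ht.2⟩

instance toEnd_neBot (T : EReal) : (toEnd T).NeBot := by
  rw [toEnd]
  split_ifs <;> infer_instance

/-- A nonincreasing function converges to its infimum, taken in `EReal` to allow `-∞`. -/
lemma exists_tendsto_toEnd {T : EReal} (hT : 0 < T) {f : ℝ → ℝ}
    (hf : ∀ s t : ℝ, 0 ≤ s → s ≤ t → (t : EReal) < T → f t ≤ f s) :
    ∃ c : EReal, Tendsto (fun t => (f t : EReal)) (toEnd T) (𝓝 c) := by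
  refine ⟨⨅ t : {t : ℝ // 0 ≤ t ∧ (t : EReal) < T}, (f t : EReal), tendsto_order.2
    ⟨fun a ha => ?_, fun a ha => ?_⟩⟩
  · filter_upwards [eventually_toEnd (t₀ := 0) (by simpa using hT)] with t ht
    exact ha.trans_le
      (iInf_le (fun t : {t : ℝ // 0 ≤ t ∧ (t : EReal) < T} => (f t : EReal)) ⟨t, ht⟩)
  · obtain ⟨⟨s, hs0, hsT⟩, hs⟩ := iInf_lt_iff.1 ha
    filter_upwards [eventually_toEnd hsT] with t ht
    exact (EReal.coe_le_coe_iff.2 (hf s t hs0 ht.1 ht.2)).trans_lt hs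

/-! ### The saddle point and optimality -/

section Main

variable {n ξ l : ℕ} {S : ControlSystem n ξ l} {r : Fin n → ℝ} {r₀ k ϑ : ℝ}
  {V R : E n → ℝ} {γ : ℝ → ℝ} {μ κ β lam : ℝ}

/-- Continuous feedback laws are admissible. -/
lemma isAdmissible_of_continuous (hS : IsHomogeneousSystem S r r₀ k ϑ) {α : E n → ℝ}
    (hα : Continuous α) (x₀ : E n) : IsAdmissible S (fun _ => α) x₀ := by
  intro ω hω _
  have hF : Continuous fun x => S.rhs x (α x) (ω x) := by
    refine (hS.f_cont.add (hα.smul hS.G₁_cont)).add (continuous_finsetSum _ fun j _ => ?_)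
    exact ((EuclideanSpace.proj (𝕜 := ℝ) j).continuous.comp hω).smul (hS.G₂_cont j)
  obtain ⟨T, x, hT, hxc, hx, hend⟩ := exists_maximal_solution hF x₀
  have hI : ∀ t : ℝ, (t : EReal) < T → ContinuousOn x (Icc 0 t) := fun t htT =>
    hxc.mono fun s hs => ⟨hs.1, IsSolution.lt_of_le htT hs.2⟩
  exact ⟨T, x, ⟨hT, fun t _ htT => memLp_comp_of_continuousOn (hI t htT) hα,
    fun t _ htT => memLp_comp_of_continuousOn (hI t htT) hω, hxc, hx⟩, hend⟩

lemma saddleGap_optLaw (x : E n) (w : E ξ) :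
    saddleGap S V R ϑ μ κ β lam x (optLaw S V R ϑ κ β x) w
      = -(β / (lam * μ) * ‖w - (lam * μ) • lieG₂ S V x‖ ^ 2) := by
  simp [saddleGap]

lemma saddleGap_worst (x : E n) (u : ℝ) :
    saddleGap S V R ϑ μ κ β lam x u ((lam * μ) • lieG₂ S V x)
      = 2 * ϑ ^ 2 / κ * (R x * (u - optLaw S V R ϑ κ β x) ^ 2) := by
  simp [saddleGap]

/-- The decay term of `l` alone exceeds `R |h|² / κ` by the choice of the gain, and the other terms
are nonnegative because `λ ≤ 2 ≤ β`. Radial unboundedness follows from positivity and a positive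
homogeneity degree. -/
lemma isMeaningful_explicitWeights (hS : IsHomogeneousSystem S r r₀ k ϑ)
    (hV : IsValueFunction r r₀ k V) (hR : IsWeight r R) (hμ : 0 < μ)
    (hγ : ∀ s, 0 ≤ s → γ s = s ^ 2 / μ)
    (hℓ : ∀ s, 0 ≤ s → legendre γ (2 * s) = μ * s ^ 2) (hκ : 0 < κ) (hβ : 2 ≤ β)
    (hlam : 0 < lam) (hlam2 : lam ≤ 2)
    (hdom : ∀ x ≠ 0, R x * ‖S.h x‖ ^ 2 < -κ * auxDecay S V R ϑ μ κ x) :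
    (explicitWeights S V γ R ϑ κ β lam).IsMeaningful := by
  have hm : 0 < k + 2 * r₀ := by have := hS.degree_pos; have := hS.r₀_pos; linarith
  have hq : 0 < 2 * k + 2 * r₀ := by have := hS.degree_pos; linarith
  have hEt : IsPosDef (fun x => 2 * β * V x) :=
    ⟨by simp [hV.pos.1], fun x hx => by have := hV.pos.2 x hx; positivity⟩
  have hlw : (fun x => lBar S V γ R ϑ κ β lam x - R x * ‖S.h x‖ ^ 2 / κ)
      = fun x => -2 * β * auxDecay S V R ϑ μ κ x
      + β * (2 - lam) * (μ * ‖lieG₂ S V x‖ ^ 2)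
      + β * (β - 2) * (κ / (2 * ϑ ^ 2) * controlPenalty S V R x)
      - κ⁻¹ * (R x * ‖S.h x‖ ^ 2) := by
    ext x
    rw [lBar_eq hV.pos hℓ]
    ring
  have hpos : IsPosDef (fun x => lBar S V γ R ϑ κ β lam x - R x * ‖S.h x‖ ^ 2 / κ) := by
    refine ⟨by simp [lBar, hS.h_zero], fun x hx => ?_⟩
    beta_reduce
    rw [lBar_eq hV.pos hℓ]
    have h1 : R x * ‖S.h x‖ ^ 2 / κ < -auxDecay S V R ϑ μ κ x := by
      rw [div_lt_iff₀ hκ]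
      have := hdom x hx
      linarith
    have h2 : 0 ≤ R x * ‖S.h x‖ ^ 2 / κ := by have := hR.pos x; positivity
    have h3 : 0 ≤ β * (2 - lam) * (μ * ‖lieG₂ S V x‖ ^ 2) := by
      have : 0 ≤ 2 - lam := by linarith
      positivity
    have h4 : 0 ≤ β * (β - 2) * (κ / (2 * ϑ ^ 2) * controlPenalty S V R x) := by
      have : 0 ≤ β - 2 := by linarith
      have := controlPenalty_nonneg (S := S) (V := V) hR x
      positivity
    nlinarith
  have hhom : IsHomogeneousFn r (2 * k + 2 * r₀)
      (fun x => lBar S V γ R ϑ κ β lam x - R x * ‖S.h x‖ ^ 2 / κ) := by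
    rw [hlw]
    exact ((((hom_auxDecay hS hV hR μ κ).const_mul _).add
      (((hV.hom_norm_lieG₂_sq hS).const_mul μ).const_mul _)).add
      (((hom_controlPenalty hS hV hR).const_mul _).const_mul _)).sub
      (((hR.hom.mul hS.hom_norm_h_sq).congr_degree (zero_add _)).const_mul _)
  have hcont : ContinuousOn (fun x => lBar S V γ R ϑ κ β lam x - R x * ‖S.h x‖ ^ 2 / κ)
      {0}ᶜ := by
    rw [hlw]
    exact (((continuousOn_const.mul (continuousOn_auxDecay hS hV hR μ κ)).add
      (continuous_const.mul (continuous_const.mul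
        ((hV.continuous_lieG₂ hS).norm.pow 2))).continuousOn).add
      (continuousOn_const.mul (continuousOn_const.mul
        (continuousOn_controlPenalty hS hV hR)))).sub
      (continuousOn_const.mul (hR.cont.mul (hS.h_cont.norm.pow 2).continuousOn))
  refine ⟨hEt, ?_, hpos, hhom.isRadiallyUnbounded hS.r_pos hq hcont hpos, fun x => ?_,
    fun x => ?_, ?_⟩
  · exact (hV.hom.const_mul _).isRadiallyUnbounded hS.r_pos hm
      (continuousOn_const.mul hV.diff.continuousOn) hEt
  · have := hR.pos x
    have := hS.ϑ_pos
    simp only [explicitWeights]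
    positivity
  · have := hR.pos x
    exact Matrix.PosDef.one.smul (by positivity)
  · refine classKInfDeriv_sq (a := β / (lam * μ)) (by positivity) fun s hs => ?_
    simp only [explicitWeights]
    rw [hγ _ (by positivity)]
    field_simp

/-- No admissible law has worst-case cost below `2 β V(x₀)`. -/
lemma le_worstCost (hS : IsHomogeneousSystem S r r₀ k ϑ)
    (hV : IsValueFunction r r₀ k V) (hR : IsWeight r R) (hμ : 0 < μ)
    (hγ : ∀ s, 0 ≤ s → γ s = s ^ 2 / μ)
    (hℓ : ∀ s, 0 ≤ s → legendre γ (2 * s) = μ * s ^ 2) (hκ : 0 < κ)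
    (hlam : 0 < lam) {a : ℝ → E n → ℝ} {x₀ : E n} (ha : IsAdmissible S a x₀) :
    ((2 * β * V x₀ : ℝ) : EReal) ≤ worstCost S (explicitWeights S V γ R ϑ κ β lam) a x₀ := by
  -- The worst-case disturbance law annihilates the negative square in `saddleGap`.
  obtain ⟨T, x, hx, hend⟩ := ha (fun z => (lam * μ) • lieG₂ S V z)
    (by have := hV.continuous_lieG₂ hS; fun_prop) (by simp [lieG₂_zero hV.pos])
  have hmot : IsMotion S (explicitWeights S V γ R ϑ κ β lam) a x₀ T
      (fun t => (lam * μ) • lieG₂ S V (x t)) x := by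
    refine ⟨⟨hx, hend⟩, fun t ht htT => ?_⟩
    have h1 := ((hx.w_mem t ht htT).integrable_norm_pow two_ne_zero).const_mul (β / (lam * μ))
    refine (intervalIntegrable_iff_integrableOn_Ioc_of_le ht).2 (h1.congr (ae_of_all _ fun s => ?_))
    simp only [explicitWeights]
    rw [hγ _ (by positivity)]
    field_simp
  refine le_trans ?_ (le_sSup ⟨T, _, x, hmot, rfl⟩)
  refine le_limsup_of_frequently_le (Eventually.frequently ?_)
  filter_upwards [eventually_toEnd (t₀ := 0) (by simpa using hx.T_pos)] with t ht
  rw [EReal.coe_le_coe_iff, hx.costUpTo_eq hS hV hR hμ hγ hℓ hκ hlam ht.1 ht.2]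
  simp only [saddleGap_worst]
  have : 0 ≤ ∫ s in (0 : ℝ)..t,
      2 * ϑ ^ 2 / κ * (R (x s) * (a s (x s) - optLaw S V R ϑ κ β (x s)) ^ 2) :=
    intervalIntegral.integral_nonneg_of_forall ht.1 fun s => by
      have := hR.pos (x s)
      positivity
  linarith

/-- Under the optimal law only the negative square of `saddleGap` survives. This monotonicity gives
both the existence of the limit and the upper bound on the worst-case cost. -/
lemma costUpTo_optLaw_anti (hS : IsHomogeneousSystem S r r₀ k ϑ)
    (hV : IsValueFunction r r₀ k V) (hR : IsWeight r R) (hμ : 0 < μ)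
    (hγ : ∀ s, 0 ≤ s → γ s = s ^ 2 / μ)
    (hℓ : ∀ s, 0 ≤ s → legendre γ (2 * s) = μ * s ^ 2) (hκ : 0 < κ) (hβ : 0 ≤ β)
    (hlam : 0 < lam) {T : EReal} {x₀ : E n} {w : ℝ → E ξ} {x : ℝ → E n}
    (hx : IsSolution S T x₀ (fun t => optLaw S V R ϑ κ β (x t)) w x) {s t : ℝ} (hs : 0 ≤ s)
    (hst : s ≤ t) (htT : (t : EReal) < T) :
    costUpTo S (explicitWeights S V γ R ϑ κ β lam) (fun t => optLaw S V R ϑ κ β (x t)) w x t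
      ≤ costUpTo S (explicitWeights S V γ R ϑ κ β lam)
        (fun t => optLaw S V R ϑ κ β (x t)) w x s := by
  have hsT := IsSolution.lt_of_le htT hst
  rw [hx.costUpTo_eq hS hV hR hμ hγ hℓ hκ hlam (hs.trans hst) htT,
    hx.costUpTo_eq hS hV hR hμ hγ hℓ hκ hlam hs hsT]
  have hi := hx.intervalIntegrable_saddleGap hS hV hR μ κ β lam (hs.trans hst) htT
  have hi' := hx.intervalIntegrable_saddleGap hS hV hR μ κ β lam hs hsT
  have h1 := intervalIntegral.integral_interval_sub_left hi hi'
  have h2 : 0 ≤ ∫ τ in s..t, β / (lam * μ) * ‖w τ - (lam * μ) • lieG₂ S V (x τ)‖ ^ 2 :=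
    intervalIntegral.integral_nonneg_of_forall hst fun τ => by positivity
  simp only [saddleGap_optLaw, intervalIntegral.integral_neg] at h1 ⊢
  linarith

lemma isMinimizer_optLaw (hS : IsHomogeneousSystem S r r₀ k ϑ)
    (hV : IsValueFunction r r₀ k V) (hR : IsWeight r R) (hμ : 0 < μ)
    (hγ : ∀ s, 0 ≤ s → γ s = s ^ 2 / μ)
    (hℓ : ∀ s, 0 ≤ s → legendre γ (2 * s) = μ * s ^ 2) (hκ : 0 < κ) (hβ : 0 ≤ β)
    (hlam : 0 < lam) :
    IsMinimizer S (explicitWeights S V γ R ϑ κ β lam) (optLaw S V R ϑ κ β)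
      (fun x₀ => 2 * β * V x₀) := by
  have hadm := isAdmissible_of_continuous hS (continuous_optLaw hS hV hR κ β)
  have hle : ∀ x₀, worstCost S (explicitWeights S V γ R ϑ κ β lam)
      (fun _ => optLaw S V R ϑ κ β) x₀ ≤ ((2 * β * V x₀ : ℝ) : EReal) := by
    intro x₀
    refine sSup_le ?_
    rintro c ⟨T, w, x, ⟨⟨hx, -⟩, -⟩, rfl⟩
    refine limsup_le_of_le (by isBoundedDefault) ?_
    have h0T : ((0 : ℝ) : EReal) < T := by simpa using hx.T_pos
    filter_upwards [eventually_toEnd h0T] with t ht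
    -- The cost never exceeds its value at time `0`, which is `2 * β * V x₀`.
    have h1 := costUpTo_optLaw_anti hS hV hR hμ hγ hℓ hκ hβ hlam hx le_rfl ht.1 ht.2
    have h2 := hx.costUpTo_eq hS hV hR hμ hγ hℓ (β := β) hκ hlam le_rfl h0T
    rw [intervalIntegral.integral_same, add_zero] at h2
    exact EReal.coe_le_coe_iff.2 (h1.trans h2.le)
  have hval : ∀ x₀, worstCost S (explicitWeights S V γ R ϑ κ β lam)
      (fun _ => optLaw S V R ϑ κ β) x₀ = ((2 * β * V x₀ : ℝ) : EReal) := fun x₀ =>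
    le_antisymm (hle x₀) (le_worstCost hS hV hR hμ hγ hℓ hκ hlam (hadm x₀))
  refine ⟨continuousOn_optLaw hS hV hR κ β, optLaw_zero hV.pos κ β, hadm, ?_, hval, ?_⟩
  · rintro x₀ T w x ⟨⟨hx, -⟩, -⟩
    exact exists_tendsto_toEnd hx.T_pos fun s t hs hst htT =>
      costUpTo_optLaw_anti hS hV hR hμ hγ hℓ hκ hβ hlam hx hs hst htT
  · intro x₀ a ha
    exact (hle x₀).trans (le_worstCost hS hV hR hμ hγ hℓ hκ hlam ha)

end Main

end InverseOptimal

theorem theorem1 {n ξ l : ℕ} (S : ControlSystem n ξ l) (r : Fin n → ℝ) (r₀ k ϑ : ℝ)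
    (hS : IsHomogeneousSystem S r r₀ k ϑ)
    (V : E n → ℝ) (hVdiff : ContDiffOn ℝ 1 V {0}ᶜ) (hVpos : IsPosDef V)
    (hVhom : IsHomogeneousFn r (k + 2 * r₀) V)
    (γ : ℝ → ℝ) (hγ : ClassKInfDeriv γ)
    (hℓ : ∀ ε : ℝ, 0 < ε → ∀ s : ℝ, 0 ≤ s →
      legendre γ (2 * ε * s) = ε ^ 2 * legendre γ (2 * s))
    (R : E n → ℝ) (hRpos : ∀ x, 0 < R x) (hRcont : ContinuousOn R {0}ᶜ)
    (hRhom : IsHomogeneousFn r 0 R) (hRaway : ∃ ρ : ℝ, 0 < ρ ∧ ∀ x, ρ ≤ |R x|) :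
    ∃ κ₀ : ℝ, 0 < κ₀ ∧ ∀ κ : ℝ, κ₀ < κ →
      StabilizesAux S V γ (baseLaw S V R ϑ κ) →
        IsPosDef (Hκ S V γ R ϑ κ) ∧
        ∀ β : ℝ, 2 ≤ β →
          (∀ lam : ℝ, 0 < lam → lam ≤ 2 →
            (explicitWeights S V γ R ϑ κ β lam).IsMeaningful ∧
            IsMinimizer S (explicitWeights S V γ R ϑ κ β lam) (optLaw S V R ϑ κ β)
              (fun x₀ => 2 * β * V x₀)) ∧
          IsISS S (optLaw S V R ϑ κ β) ∧
          ((∃ μ : ℝ, 0 < μ ∧ ∀ s : ℝ, 0 ≤ s → γ s = 1 / μ * s ^ 2) →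
            IsFiniteGainL2 S (optLaw S V R ϑ κ β)) := by
  have hV : IsValueFunction r r₀ k V := ⟨hVdiff, hVpos, hVhom⟩
  have hR : IsWeight r R := ⟨hRpos, hRcont, hRhom⟩
  -- The constant `μ` depends on `γ` alone, so the threshold `κ₀` obtained from it is fixed before
  -- `κ`, `β` and `lam`.
  obtain ⟨μ, hμ, hγsq, hℓsq⟩ := exists_eq_sq_of_legendre hγ hℓ
  obtain ⟨κ₀, hκ₀, hdom⟩ := exists_gain_threshold hS hV hR μ
  refine ⟨κ₀, hκ₀, fun κ hκ hstab => ?_⟩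
  have hκ0 : 0 < κ := hκ₀.trans hκ
  have hneg := (stabilizesAux_iff hℓsq κ).1 hstab
  have hout := hdom κ hκ hneg
  refine ⟨⟨by simp [Hκ], fun x hx => ?_⟩,
    fun β hβ => ⟨fun lam hlam hlam2 => ⟨?_, ?_⟩, ?_, fun _ => ?_⟩⟩
  · rw [Hκ, if_neg hx, auxDecay_eq hℓsq κ hx]
    linarith [hout x hx]
  · exact isMeaningful_explicitWeights hS hV hR hμ hγsq hℓsq hκ0 hβ hlam hlam2 hout
  · exact isMinimizer_optLaw hS hV hR hμ hγsq hℓsq hκ0 (by linarith) hlam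
  · exact isISS_optLaw hS hV hR hμ hκ0 (by linarith) hneg
  · exact isFiniteGainL2_optLaw hS hV hR hμ hκ0 (by linarith) hneg
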